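/- **Setting.** Let $G=(V,E,s,t,c,e)$ be a finite network: $E\subseteq V\times V$ is symmetric, $s\ne t$, $c\colon E\to\mathbb N_0$ is the capacity, $e\colon V\setminus\{s,t\}\to\mathbb N_0$ is the excess, and $e(s)=\infty$, $e(t)=0$. A *preflow* is a map $f\colon E\to\mathbb Z$ with $f\le c$, $f(u,v)=-f(v,u)$ and $e(v)+\sum_u f(u,v)\ge 0$ for all $v$; its value is $|f|=\sum_u f(u,t)$. The residual network $G_f$ has capacities $c_f=c-f$, excesses $e_f(v)=e(v)+\sum_u f(u,v)$ for $v\neq t$, and $e_f(t)=0$. Write $u\to Y$ if there is a path (possibly of length $0$) of edges of positive capacity from $u$ to a vertex of $Y$. Fix a partition $R_1,\dots,R_K$ of $V\setminus\{s,t\}$ into regions. For a region $R$ let $B^R$ be the set of vertices $w\notin R\cup\{s,t\}$ with $(u,w)\in E$ for some $u\in R$. Let $\mathcal B=\bigcup_k B^{R_k}$ and $d^\infty=|\mathcal B|$. An edge is *inter-region* if its endpoints lie in two different regions. A labeling $d\colon V\to\{0,\dots,d^\infty\}$ is *valid* (for the region distance, which counts the inter-region edges on a path to $t$) in a network if $d(t)=0$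 and, for every edge $(u,v)$ of positive capacity, $d(u)\le d(v)+1$ if the edge is inter-region and $d(u)\le d(v)$ otherwise. A vertex $v$ is *active* if it has positive excess and $d(v)<d^\infty$. The *region network* $G^R$ has vertices $R\cup B^R\cup\{s,t\}$ and all edges of $E$ within $R\cup\{s,t\}$ and between $R$ and $B^R$; its capacities and its excesses on $R\cup\{s,t\}$ are those of $G$, except that the edges from $B^R$ to $R$ get capacity $0$. **ARD** on $(G^R,d)$: start with $f=0$ in $G^R$. For $j=0,1,\dots,d^\infty$, with $T_j=\{t\}\cup\{v\in B^R : d(v)<j\}$, do the following as long as possible: choose any path without repeated vertices, of edges of positive residual capacity in $G^R_f$, from a vertex $v_0\in R$ with $e_f(v_0)>0$ to a vertex of $T_j$, and augment $f$ along it by the minimum of $e_f(v_0)$ and the residual capacities of its edges. Then *region-relabel*: for every $u\in R$ set $d(u)=\min\{j : u\to T_j\}$ if $u\to T_{d^\infty}$ in $G^R_f$, and $d(u)=d^\infty$ otherwise; other labels are kept. **S-ARD**: saturate all edges $(s,v)$, $v\ne s$, replace $G$ by the residual network, and set $d(s)=d^\infty$ and $d=0$ elsewhere. While there is an active vertex,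 perform a *sweep*: for $k=1,\dots,K$ run ARD on the region network of $R_k$ in the current network, apply the resulting flow (pass to the residual network) and the resulting labels on $R_k$, and then, optionally, apply the global gap heuristic: for some $g>0$ such that no vertex of $\mathcal B$ has label $g$, set all labels larger than $g$ to $d^\infty$. **Theorem.** For every choice of augmenting paths and of the optional gap steps, S-ARD terminates (every execution is finite), after at most $2|\mathcal B|^2+1$ sweeps. On termination, the total flow $f$ is a preflow in the input network $G$, the labeling $d$ is valid in $G_f$, and no vertex is active; if $\mathcal B\neq\emptyset$, then $f$ is a maximum preflow in $G$. -/

import Mathlib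

open Relation

noncomputable section

/-- A network `(V, E, s, t, c, e)`. Residual and region networks are again of this form. The source is
regarded as having infinite excess, so the number `e s` is never used. -/
structure Network (V : Type*) where
  E : V → V → Prop
  s : V
  t : V
  c : V → V → ℤ
  e : V → ℤ

namespace Network

variable {V : Type*} (G : Network V)

/-- The standing assumptions on an input network: `s ≠ t`, symmetric edge set, capacities in `ℕ` (extended
by `0` outside `E`), excesses in `ℕ`, and the convention `e t = 0`. -/
structure IsProper : Prop where
  s_ne_t : G.s ≠ G.t
  symm : ∀ u v, G.E u v → G.E v u
  c_nonneg : ∀ u v, G.E u v → 0 ≤ G.c u v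
  c_off : ∀ u v, ¬ G.E u v → G.c u v = 0
  e_nonneg : ∀ v, v ≠ G.s → 0 ≤ G.e v
  e_t : G.e G.t = 0

/-- `f : E → ℤ` (extended by `0` outside `E`) is a preflow. The preflow constraint at `s` is void, since
the source has infinite excess. -/
structure IsPreflow [Fintype V] (f : V → V → ℤ) : Prop where
  off : ∀ u v, ¬ G.E u v → f u v = 0
  capacity : ∀ u v, G.E u v → f u v ≤ G.c u v
  antisymm : ∀ u v, f u v = - f v u
  preflow : ∀ v, v ≠ G.s → 0 ≤ G.e v + ∑ u, f u v

/-- The flow value `|f|`. -/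
def value [Fintype V] (f : V → V → ℤ) : ℤ := ∑ u, f u G.t

/-- `f` is a preflow of maximum value. -/
def IsMaxPreflow [Fintype V] (f : V → V → ℤ) : Prop :=
  G.IsPreflow f ∧ ∀ f', G.IsPreflow f' → G.value f' ≤ G.value f

open Classical in
/-- The residual network `G_f`; the excess of the sink stays `0`. -/
def residual [Fintype V] (f : V → V → ℤ) : Network V where
  E := G.E
  s := G.s
  t := G.t
  c := fun u v => G.c u v - f u v
  e := fun v => if v = G.t then 0 else G.e v + ∑ u, f u v

/-- `v` has positive excess (`e s = ∞`, `e t = 0`). -/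
def HasExcess (v : V) : Prop := v ≠ G.t ∧ (v = G.s ∨ 0 < G.e v)

/-- An edge of strictly positive capacity. -/
def PosEdge (u v : V) : Prop := G.E u v ∧ 0 < G.c u v

/-- `v → w`: there is a path, possibly of length `0`, of edges of positive capacity. -/
def Reach (v w : V) : Prop := ReflTransGen G.PosEdge v w

/-- `v → Y`. -/
def ReachSet (v : V) (Y : Set V) : Prop := ∃ y ∈ Y, G.Reach v y

/-- The boundary `B^R` of a region `R`. -/
def regionBoundary (R : Finset V) : Set V :=
  {w | w ∉ R ∧ w ≠ G.s ∧ w ≠ G.t ∧ ∃ u ∈ R, G.E u w}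

open Classical in
/-- The region network `G^R`. Its vertex set `R ∪ B^R ∪ {s, t}` is kept inside `V`: no edge is incident
to any other vertex. -/
def regionNetwork (R : Finset V) : Network V where
  E := fun u v => G.E u v ∧
    (((u ∈ R ∨ u = G.s ∨ u = G.t) ∧ (v ∈ R ∨ v = G.s ∨ v = G.t)) ∨
      (u ∈ R ∧ v ∈ G.regionBoundary R) ∨ (u ∈ G.regionBoundary R ∧ v ∈ R))
  s := G.s
  t := G.t
  c := fun u v =>
    if (G.E u v ∧ (((u ∈ R ∨ u = G.s ∨ u = G.t) ∧ (v ∈ R ∨ v = G.s ∨ v = G.t)) ∨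
      (u ∈ R ∧ v ∈ G.regionBoundary R))) then G.c u v else 0
  e := fun v => if v ∈ R ∨ v = G.s ∨ v = G.t then G.e v else 0

/-- `v₀ :: l` is a path without repeated vertices, of edges of positive capacity, from a vertex of `X`
with positive excess to a vertex of `Y`. -/
def IsAugPath (X Y : Set V) (v₀ : V) (l : List V) : Prop :=
  v₀ ∈ X ∧ G.HasExcess v₀ ∧ l.getLastD v₀ ∈ Y ∧ (v₀ :: l).Nodup ∧ (v₀ :: l).IsChain G.PosEdge

/-- The amount `min (e v₀, min_i c (v_{i-1}, v_i))` that is augmented along the path `v₀ :: l`. -/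
def bottleneck (v₀ : V) (l : List V) : ℤ :=
  ((v₀ :: l).zip l).foldr (fun a m => min (G.c a.1 a.2) m) (G.e v₀)

end Network

open Classical in
/-- The flow of `Δ` units along the path with vertex list `p`. -/
def pathFlow {V : Type*} (p : List V) (Δ : ℤ) (u v : V) : ℤ :=
  (if (u, v) ∈ p.zip p.tail then Δ else 0) - (if (v, u) ∈ p.zip p.tail then Δ else 0)

namespace Network

variable {V : Type*} [Fintype V] (G : Network V)

/-- One iteration of the loop of `Augment(X, Y)` in the network `G`: the flow `g` becomes `g'` by
augmenting along some path of the residual network `G_g`. -/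
def AugmentStep (X Y : Set V) (g g' : V → V → ℤ) : Prop :=
  ∃ v₀ l, (G.residual g).IsAugPath X Y v₀ l ∧
    g' = fun u v => g u v + pathFlow (v₀ :: l) ((G.residual g).bottleneck v₀ l) u v

/-- The regions are pairwise disjoint and cover exactly `V ∖ {s, t}`. -/
structure IsRegionPartition {K : ℕ} (R : Fin K → Finset V) : Prop where
  disjoint : ∀ i j, i ≠ j → Disjoint (R i) (R j)
  cover : ∀ v, (∃ k, v ∈ R k) ↔ v ≠ G.s ∧ v ≠ G.t

open Classical in
/-- The boundary `𝓑 = ⋃ₖ B^{R_k}`. -/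
def boundary {K : ℕ} (R : Fin K → Finset V) : Finset V :=
  {v | ∃ k, v ∈ G.regionBoundary (R k)}

/-- `d^∞ = |𝓑|`. -/
def dInf {K : ℕ} (R : Fin K → Finset V) : ℕ := (G.boundary R).card

/-- `u` and `v` lie in two different regions. -/
def InterRegion {K : ℕ} (R : Fin K → Finset V) (u v : V) : Prop :=
  ∃ i j, i ≠ j ∧ u ∈ R i ∧ v ∈ R j

/-- Validity of a labeling `d : V → {0, …, d^∞}` with respect to the region distance, in which exactly
the inter-region edges have length `1` and all other edges have length `0`. -/
structure IsValidLabeling {K : ℕ} (R : Fin K → Finset V) (d : V → ℕ) : Prop where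
  le_dInf : ∀ v, d v ≤ G.dInf R
  sink : d G.t = 0
  inter : ∀ u v, G.PosEdge u v → InterRegion R u v → d u ≤ d v + 1
  intra : ∀ u v, G.PosEdge u v → ¬ InterRegion R u v → d u ≤ d v

/-- `v` is active in `G` with respect to the labeling `d`. -/
def IsActive {K : ℕ} (R : Fin K → Finset V) (d : V → ℕ) (v : V) : Prop :=
  G.HasExcess v ∧ d v < G.dInf R

/-- The target set `T_j` of stage `j` of the discharge of the region `R`. -/
def target (R : Finset V) (d : V → ℕ) (j : ℕ) : Set V :=
  {G.t} ∪ {v | v ∈ G.regionBoundary R ∧ d v < j}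

end Network

namespace SARD

variable {V : Type*}

/-- The position of the algorithm in its program:
* `test`: at the test of the `while` loop;
* `forLoop k`: in a sweep, the regions of index below `k` have been processed;
* `stage k j g`: in `ARD` on the region network of `R_k`, stage `j`, with current flow `g`;
* `halted`: the algorithm has terminated. -/
inductive Control (V : Type*) (K : ℕ) where
  | test : Control V K
  | forLoop (k : ℕ) : Control V K
  | stage (k : Fin K) (j : ℕ) (g : V → V → ℤ) : Control V K
  | halted : Control V K

/-- A state of the algorithm. The current network is the residual network, with respect to `f`, of the
input network; `d` is the labeling; `sweeps` is the number of sweeps begun so far. -/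
structure State (V : Type*) (K : ℕ) where
  f : V → V → ℤ
  d : V → ℕ
  sweeps : ℕ
  control : Control V K

variable [Fintype V] (G : Network V) {K : ℕ} (R : Fin K → Finset V)

open Classical in
/-- The preflow saturating all edges from `s` to other vertices. -/
def initFlow (u v : V) : ℤ :=
  if u = v then 0 else if u = G.s then G.c u v else if v = G.s then - G.c v u else 0

open Classical in
/-- The state after the initialization: the edges out of `s` are saturated, `d s = d^∞`, and `d = 0`
elsewhere. -/
def initState : State V K where
  f := initFlow G
  d := fun v => if v = G.s then G.dInf R else 0
  sweeps := 0
  control := .test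

open Classical in
/-- Region-relabel at the end of `ARD`: `N` is the region network, `T j` are the target sets, `D = d^∞`;
labels outside the region `A` are kept. -/
def regionRelabel (N : Network V) (A : Finset V) (T : ℕ → Set V) (D : ℕ) (d : V → ℕ) (u : V) : ℕ :=
  if u ∈ A then
    if N.ReachSet u (T D) then sInf {j | N.ReachSet u (T j)} else D
  else d u

open Classical in
/-- The global gap heuristic, turning `d` into `d'`: if no boundary vertex has the label `g > 0`, then all
labels above `g` are raised to `d^∞`. -/
def GapStep (d d' : V → ℕ) : Prop :=
  ∃ g, 0 < g ∧ (∀ v ∈ G.boundary R, d v ≠ g) ∧ d' = fun u => if g < d u then G.dInf R else d u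

/-- The region network of `R_k` built from the current network. -/
def currentRegion (f : V → V → ℤ) (k : Fin K) : Network V :=
  (G.residual f).regionNetwork (R k)

/-- The elementary steps of the sequential region discharge algorithm with discharge operation `ARD`. The
choice of augmenting paths, and whether the gap heuristic is applied, are arbitrary. -/
inductive Step : State V K → State V K → Prop
  /-- No active vertices: the algorithm terminates. -/
  | halt (f d n) (h : ∀ v, ¬ (G.residual f).IsActive R d v) :
      Step ⟨f, d, n, .test⟩ ⟨f, d, n, .halted⟩
  /-- There is an active vertex: a new sweep begins. -/
  | sweep (f d n) (v : V) (h : (G.residual f).IsActive R d v) :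
      Step ⟨f, d, n, .test⟩ ⟨f, d, n + 1, .forLoop 0⟩
  /-- All regions have been processed: the sweep ends. -/
  | sweepEnd (f d n) :
      Step ⟨f, d, n, .forLoop K⟩ ⟨f, d, n, .test⟩
  /-- `ARD` is called on region `R_k`; it starts with stage `0` and zero flow. -/
  | call (f d n) (k : Fin K) :
      Step ⟨f, d, n, .forLoop k⟩ ⟨f, d, n, .stage k 0 0⟩
  /-- One augmentation in stage `j`. -/
  | augment (f d n) (k : Fin K) (j : ℕ) (g g' : V → V → ℤ)
      (h : (currentRegion G R f k).AugmentStep (R k) (G.target (R k) d j) g g') :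
      Step ⟨f, d, n, .stage k j g⟩ ⟨f, d, n, .stage k j g'⟩
  /-- No augmenting path is left in stage `j < d^∞`: the next stage begins. -/
  | nextStage (f d n) (k : Fin K) (j : ℕ) (g : V → V → ℤ) (hj : j < G.dInf R)
      (h : ∀ g', ¬ (currentRegion G R f k).AugmentStep (R k) (G.target (R k) d j) g g') :
      Step ⟨f, d, n, .stage k j g⟩ ⟨f, d, n, .stage k (j + 1) g⟩
  /-- No augmenting path is left in stage `d^∞`: region-relabel is run, the flow and the labels are
  applied to the network, the gap heuristic is optionally applied, and the next region is taken. -/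
  | finish (f d n) (k : Fin K) (g : V → V → ℤ) (d' d'' : V → ℕ)
      (h : ∀ g', ¬ (currentRegion G R f k).AugmentStep (R k) (G.target (R k) d (G.dInf R)) g g')
      (hd' : d' = regionRelabel ((currentRegion G R f k).residual g) (R k)
        (G.target (R k) d) (G.dInf R) d)
      (hd'' : d'' = d' ∨ GapStep G R d' d'') :
      Step ⟨f, d, n, .stage k (G.dInf R) g⟩
        ⟨fun u v => f u v + g u v, d'', n, .forLoop (k + 1)⟩

/-- `σ` occurs in some execution of the algorithm. -/
def Reachable (σ : State V K) : Prop := ReflTransGen (Step G R) (initState G R) σ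

end SARD

end

/-! Write `D` for `d^∞`. The labels are lower bounds for the region distance to the sink, and the
proof shows that one call of ARD preserves this while making progress.

Inside one call the targets `T_0 ⊆ T_1 ⊆ ...` are exhausted in turn. At stage `j` a vertex of the
region with excess reaches no `T_i` with `i < j`. Hence every vertex of an augmenting path reaches
`T_i` for all `i ≥ j`, and none does for `i < j`. New residual edges join vertices of that path, so
no target set ever becomes reachable from a new vertex (`reachSet_of_uniform`,
`StageInvariant.augment`). Therefore labels do not decrease (`StageInvariant.le_regionRelabel`).
Moreover, once flow has entered a boundary vertex `w`, the tail of a reopened edge out of `w`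
creates no shortcut: its head does not reach `T_{d(w)}`. This gives validity
(`StageInvariant.valid_step`). After the call no vertex of the region is active, and any newly
active vertex `v` lies on the boundary and is charged to a formerly active `x` in the region with
new label `d'(x) > d(v)` (`StageInvariant.isActive_or`). That `x` was active, rather than merely in
excess, needs a further invariant `stuck`: excess at label `D` cannot leave its region towards
`T_D`.

For the number of sweeps, a vertex `v` active after `n ≥ 1` sweeps is a boundary vertex with `d(v) +
n ≤ ∑_𝓑 d + D`. When the excess moves from `x` to `v`, the sum rises by at least `d'(x) - d(x) ≥
d(v) + 1 - d(x)`, which pays for the change of vertex and for one more sweep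
(`SweepBound.discharge`). Since the sum is at most `D²`, this gives `n ≤ D² + D ≤ 2D²`. A
lexicographic measure then bounds the elementary steps.

At the end all excess, including that of `s`, has label `D`. If `D > 0`, such a vertex does not
reach the sink: the path would cross all `D + 1` labels on a boundary of only `D` vertices
(`IsValidLabeling.not_reach_sink`). The set of vertices that reach `t` is then a cut certifying
maximality. -/

/-! ### Flow along a simple path -/

theorem pathFlow_antisymm {V : Type*} (p : List V) (Δ : ℤ) (u v : V) :
    pathFlow p Δ u v = - pathFlow p Δ v u := by
  unfold pathFlow; ring

open Classical in
-- Without repeated vertices, the first edge occurs in the rest of the path in neither direction, so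
-- the membership tests in `pathFlow` split into a sum; this is what makes induction on the path
-- possible.
theorem pathFlow_cons_cons {V : Type*} {a b : V} {l : List V} (Δ : ℤ) (h : (a :: b :: l).Nodup)
    (u v : V) : pathFlow (a :: b :: l) Δ u v =
      (if u = a then if v = b then Δ else 0 else 0) - (if u = b then if v = a then Δ else 0 else 0)
        + pathFlow (b :: l) Δ u v := by
  have ha : ∀ y, (a, y) ∉ (b :: l).zip l := fun y hy =>
    (List.nodup_cons.1 h).1 (List.of_mem_zip hy).1
  have hb : ∀ y, (y, a) ∉ (b :: l).zip l := fun y hy =>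
    (List.nodup_cons.1 h).1 (List.mem_cons_of_mem _ (List.of_mem_zip hy).2)
  have hab : a ≠ b := fun e => (List.nodup_cons.1 h).1 (by simp [e])
  simp only [pathFlow, List.tail_cons, List.zip_cons_cons, List.mem_cons, Prod.mk.injEq]
  by_cases h1 : u = a
  · subst h1
    have := ha v
    have := hb v
    simp_all
  · by_cases h2 : v = a
    · subst h2
      have := ha u
      have := hb u
      simp_all
    · simp_all
      congr

open Classical in
theorem sum_pathFlow {V : Type*} [Fintype V] (Δ : ℤ) (v : V) (l : List V) :
    ∀ a : V, (a :: l).Nodup → ∑ u, pathFlow (a :: l) Δ u v =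
      (if v = l.getLastD a then Δ else 0) - (if v = a then Δ else 0) := by
  induction l with
  | nil => intro a _; simp [pathFlow]
  | cons b l ih =>
    intro a h
    simp only [pathFlow_cons_cons Δ h, Finset.sum_add_distrib, Finset.sum_sub_distrib,
      ih b (List.nodup_cons.1 h).2, List.getLastD_cons, Finset.sum_ite_eq', Finset.mem_univ, if_true]
    ring

/-! ### Augmentation steps and reachability -/

namespace Network

variable {V : Type*} (G : Network V)

theorem reach_of_isChain (l : List V) : ∀ a : V, (a :: l).IsChain G.PosEdge →
    ∀ x ∈ a :: l, G.Reach a x ∧ G.Reach x (l.getLastD a) := by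
  induction l with
  | nil => intro a _ x hx; simp at hx; subst hx; exact ⟨.refl, .refl⟩
  | cons b l ih =>
    intro a h x hx
    rw [List.isChain_cons_cons] at h
    rw [List.getLastD_cons]
    rcases List.mem_cons.1 hx with rfl | hx
    · exact ⟨.refl, .head h.1 (ih b h.2 b (by simp)).2⟩
    · exact ⟨.head h.1 (ih b h.2 x hx).1, (ih b h.2 x hx).2⟩

theorem posEdge_of_mem_zip (l : List V) : ∀ a : V, (a :: l).IsChain G.PosEdge →
    ∀ u v, (u, v) ∈ (a :: l).zip l → G.PosEdge u v := by
  induction l with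
  | nil => intro a _ u v h; simp at h
  | cons b l ih =>
    intro a h u v huv
    rw [List.isChain_cons_cons] at h
    rw [List.zip_cons_cons, List.mem_cons] at huv
    rcases huv with huv | huv
    · cases huv; exact h.1
    · exact ih b h.2 u v huv

theorem bottleneck_le_excess (v₀ : V) (l : List V) : G.bottleneck v₀ l ≤ G.e v₀ := by
  unfold bottleneck
  induction (v₀ :: l).zip l with
  | nil => simp
  | cons a m ih => exact (min_le_right _ _).trans ih

theorem bottleneck_le_capacity (v₀ : V) (l : List V) {u v : V} (h : (u, v) ∈ (v₀ :: l).zip l) :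
    G.bottleneck v₀ l ≤ G.c u v := by
  unfold bottleneck
  generalize (v₀ :: l).zip l = m at h
  induction m with
  | nil => simp at h
  | cons a m ih =>
    rcases List.mem_cons.1 h with rfl | h
    · exact min_le_left _ _
    · exact (min_le_right _ _).trans (ih h)

theorem bottleneck_pos {v₀ : V} {l : List V} (h₀ : 0 < G.e v₀)
    (h : ∀ u v, (u, v) ∈ (v₀ :: l).zip l → 0 < G.c u v) : 0 < G.bottleneck v₀ l := by
  unfold bottleneck
  generalize (v₀ :: l).zip l = m at h
  induction m with
  | nil => simpa
  | cons a m ih =>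
    exact lt_min (h a.1 a.2 (by simp)) (ih fun u v huv => h u v (List.mem_cons_of_mem _ huv))

open Classical in
/-- An augmentation adds a flow `φ` of `Δ > 0` units from `v₀ ∈ X` to `w ∈ Y`, carried by vertices which
can be reached from `v₀` and which reach `w`. -/
theorem AugmentStep.exists_flow [Fintype V] {X Y : Set V} {g g' : V → V → ℤ}
    (h : G.AugmentStep X Y g g') (hs : G.s ∉ X) :
    ∃ (v₀ w : V) (Δ : ℤ) (P : Set V) (φ : V → V → ℤ), v₀ ∈ X ∧ w ∈ Y ∧ 0 < Δ ∧
      (G.residual g).HasExcess v₀ ∧ Δ ≤ (G.residual g).e v₀ ∧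
      v₀ ∈ P ∧ (∀ x ∈ P, (G.residual g).Reach v₀ x ∧ (G.residual g).Reach x w) ∧
      (∀ u v, φ u v = - φ v u) ∧
      (∀ u v, φ u v ≤ 0 ∨
        u ∈ P ∧ v ∈ P ∧ (G.residual g).PosEdge u v ∧ φ u v ≤ (G.residual g).c u v) ∧
      (∀ v, ∑ u, φ u v = (if v = w then Δ else 0) - (if v = v₀ then Δ else 0)) ∧
      g' = fun u v => g u v + φ u v := by
  obtain ⟨v₀, l, ⟨hX, he, hY, hnd, hch⟩, rfl⟩ := h
  have hpos : 0 < (G.residual g).e v₀ := he.2.resolve_left fun e => hs (e ▸ hX)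
  have hΔ := bottleneck_pos (G.residual g) (l := l) hpos
    fun u v huv => (posEdge_of_mem_zip _ l v₀ hch u v huv).2
  refine ⟨v₀, l.getLastD v₀, (G.residual g).bottleneck v₀ l, {x | x ∈ v₀ :: l},
    pathFlow (v₀ :: l) ((G.residual g).bottleneck v₀ l), hX, hY, hΔ, he,
    bottleneck_le_excess _ v₀ l, by simp, reach_of_isChain _ l v₀ hch, pathFlow_antisymm _ _,
    fun u v => ?_, fun v => sum_pathFlow _ v l v₀ hnd, rfl⟩
  by_cases huv : (u, v) ∈ (v₀ :: l).zip l
  · refine Or.inr ⟨(List.of_mem_zip huv).1, List.mem_cons_of_mem _ (List.of_mem_zip huv).2,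
      posEdge_of_mem_zip _ l v₀ hch u v huv, ?_⟩
    refine le_trans ?_ (bottleneck_le_capacity _ v₀ l huv)
    unfold pathFlow
    rw [List.tail_cons, if_pos huv]
    split_ifs <;> linarith
  · left
    unfold pathFlow
    rw [List.tail_cons, if_neg huv]
    split_ifs <;> linarith

theorem ReachSet.mono {v : V} {Y Y' : Set V} (h : G.ReachSet v Y) (hY : Y ⊆ Y') : G.ReachSet v Y' :=
  h.imp fun _ hy => ⟨hY hy.1, hy.2⟩

theorem ReachSet.head {u v : V} {Y : Set V} (huv : G.PosEdge u v) (h : G.ReachSet v Y) :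
    G.ReachSet u Y :=
  h.imp fun _ hy => ⟨hy.1, .head huv hy.2⟩

theorem Reach.trans_reachSet {u v : V} {Y : Set V} (huv : G.Reach u v) (h : G.ReachSet v Y) :
    G.ReachSet u Y :=
  h.imp fun _ hy => ⟨hy.1, ReflTransGen.trans huv hy.2⟩

/-- Induction along a path to `Y`. -/
theorem ReachSet.induction {Y : Set V} {p : V → Prop} (hY : ∀ y ∈ Y, p y)
    (hp : ∀ u v, G.PosEdge u v → G.ReachSet v Y → p v → p u) {u : V} (h : G.ReachSet u Y) : p u := by
  obtain ⟨y, hy, h⟩ := h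
  induction h using ReflTransGen.head_induction_on with
  | refl => exact hY y hy
  | head huv hv ih => exact hp _ _ huv ⟨y, hy, hv⟩ ih

/-- The vertices that reach `Y` stay the same or become fewer when flow is sent through a set of vertices
all of which reach `Y`, or none of which does. -/
theorem reachSet_of_uniform {G' : Network V} {Y P : Set V}
    (hE : ∀ u v, G'.PosEdge u v → G.PosEdge u v ∨ u ∈ P ∧ v ∈ P)
    (hP : (∀ x ∈ P, G.ReachSet x Y) ∨ ∀ x ∈ P, ¬ G.ReachSet x Y) {u : V} (h : G'.ReachSet u Y) :
    G.ReachSet u Y := by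
  refine ReachSet.induction G' (p := fun u => G.ReachSet u Y) (fun y hy => ⟨y, hy, .refl⟩) (fun a b hab _ hb => ?_) h
  rcases hE a b hab with h | ⟨ha, hb'⟩
  · exact hb.head G h
  · rcases hP with hP | hP
    · exact hP a ha
    · exact absurd hb (hP b hb')

end Network

/-! ### Exhausted stages and region networks -/

namespace Network

section Paths

variable {V : Type*} (G : Network V)

theorem getLastD_append_cons (l₁ l₂ : List V) (a x : V) :
    (l₁ ++ a :: l₂).getLastD x = l₂.getLastD a := by
  induction l₁ generalizing x with
  | nil => rw [List.nil_append, List.getLastD_cons]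
  | cons b l ih => rw [List.cons_append, List.getLastD_cons, ih]

/-- Loop erasure: if the new first vertex already occurs on the path, keep only the part of the path
from that occurrence on. -/
theorem Reach.exists_path {a b : V} (h : G.Reach a b) :
    ∃ l : List V, (a :: l).Nodup ∧ (a :: l).IsChain G.PosEdge ∧ l.getLastD a = b := by
  induction h using ReflTransGen.head_induction_on with
  | refl => exact ⟨[], by simp, by simp, rfl⟩
  | @head a c hac _ ih =>
    obtain ⟨l, hnd, hch, hl⟩ := ih
    by_cases ha : a ∈ c :: l
    · obtain ⟨l₁, l₂, e⟩ := List.append_of_mem ha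
      have hsuf : a :: l₂ <:+ c :: l := ⟨l₁, e.symm⟩
      refine ⟨l₂, hnd.sublist hsuf.sublist, hch.suffix hsuf, ?_⟩
      have hlast := getLastD_append_cons l₁ l₂ a c
      rw [← e, List.getLastD_cons] at hlast
      exact hlast.symm.trans hl
    · exact ⟨c :: l, List.nodup_cons.2 ⟨ha, hnd⟩, List.isChain_cons_cons.2 ⟨hac, hch⟩,
        by rw [List.getLastD_cons, hl]⟩

theorem not_reachSet_of_no_augmentStep [Fintype V] {X Y : Set V} {g : V → V → ℤ}
    (h : ∀ g', ¬ G.AugmentStep X Y g g') {v : V} (hv : v ∈ X) (he : (G.residual g).HasExcess v) :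
    ¬ (G.residual g).ReachSet v Y := by
  rintro ⟨y, hy, hr⟩
  obtain ⟨l, hnd, hch, rfl⟩ := hr.exists_path
  exact h _ ⟨v, l, ⟨hv, he, hy, hnd, hch⟩, rfl⟩

end Paths

section Region

variable {V : Type*} {N : Network V} {A : Finset V} {d : V → ℕ}

theorem regionNetwork_E_of_left {u v : V} (hu : u ∈ A) (h : N.E u v) : (N.regionNetwork A).E u v := by
  refine ⟨h, ?_⟩
  by_cases hv : v ∈ A ∨ v = N.s ∨ v = N.t
  · exact .inl ⟨.inl hu, hv⟩
  · push Not at hv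
    exact .inr (.inl ⟨hu, hv.1, hv.2.1, hv.2.2, u, hu, h⟩)

theorem regionNetwork_E_symm (hs : ∀ u v, N.E u v → N.E v u) {u v : V}
    (h : (N.regionNetwork A).E u v) : (N.regionNetwork A).E v u := by
  obtain ⟨h, h'⟩ := h
  exact ⟨hs u v h, by tauto⟩

theorem regionNetwork_c_of_left {u v : V} (hu : u ∈ A) (h : N.E u v) :
    (N.regionNetwork A).c u v = N.c u v := by
  obtain ⟨h, h'⟩ := regionNetwork_E_of_left hu h
  refine if_pos ⟨h, ?_⟩
  rcases h' with h' | h' | h'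
  · exact .inl h'
  · exact .inr h'
  · exact absurd hu h'.1.1

theorem regionNetwork_c_eq_zero_or (u v : V) :
    (N.regionNetwork A).c u v = 0 ∨ (N.regionNetwork A).c u v = N.c u v := by
  by_cases h : (N.E u v ∧ (((u ∈ A ∨ u = N.s ∨ u = N.t) ∧ (v ∈ A ∨ v = N.s ∨ v = N.t)) ∨
      (u ∈ A ∧ v ∈ N.regionBoundary A)))
  · exact .inr (if_pos h)
  · exact .inl (if_neg h)

theorem PosEdge.of_regionNetwork {u v : V} (h : (N.regionNetwork A).PosEdge u v) : N.PosEdge u v := by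
  refine ⟨h.1.1, ?_⟩
  rcases regionNetwork_c_eq_zero_or (N := N) (A := A) u v with h' | h'
  · exact absurd h.2 (by rw [h']; exact lt_irrefl 0)
  · exact h' ▸ h.2

/-- Edges from the boundary to the region have capacity `0`, so before any flow is sent a path can
meet the boundary only at its end. -/
theorem not_posEdge_regionNetwork_of_boundary {u v : V} (hu : u ∈ N.regionBoundary A) :
    ¬ (N.regionNetwork A).PosEdge u v := by
  intro h
  have h' := h.2
  unfold regionNetwork at h'
  simp only at h'
  split_ifs at h' with h''
  · have := hu.1
    have := hu.2.1
    have := hu.2.2.1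
    tauto
  · exact lt_irrefl _ h'

theorem regionNetwork_e_of_mem {v : V} (hv : v ∈ A) : (N.regionNetwork A).e v = N.e v :=
  if_pos (.inl hv)

theorem target_mono {i j : ℕ} (h : i ≤ j) : N.target A d i ⊆ N.target A d j := by
  intro v hv
  rcases hv with hv | hv
  · exact .inl hv
  · exact .inr ⟨hv.1, hv.2.trans_le h⟩

end Region

/-! ### The invariant of one discharge -/

variable {V : Type*} (N : Network V) (A : Finset V) (d : V → ℕ) (D : ℕ)

/-- What is required of the network `N` and the labeling `d` before the region `A` is discharged. -/
structure DischargeReady : Prop where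
  s_not_mem : N.s ∉ A
  t_not_mem : N.t ∉ A
  s_ne_t : N.s ≠ N.t
  symm : ∀ u v, N.E u v → N.E v u
  c_nonneg : ∀ u v, 0 ≤ N.c u v
  e_nonneg : ∀ v ∈ A, 0 ≤ N.e v
  source : ∀ v, v ≠ N.s → ¬ N.PosEdge N.s v
  d_le : ∀ v, d v ≤ D
  d_t : d N.t = 0
  d_le_of_mem : ∀ u ∈ A, ∀ v ∈ A, N.PosEdge u v → d u ≤ d v
  d_le_of_sink : ∀ u ∈ A, N.PosEdge u N.t → d u = 0
  d_le_of_boundary : ∀ u ∈ A, ∀ w ∈ N.regionBoundary A, N.PosEdge u w → d u ≤ d w + 1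
  -- ARD also augments from inactive excess. This clause ensures that no flow leaves a vertex of
  -- label `D`, so that every sender is active.
  stuck : ∀ x ∈ A, 0 < N.e x → d x = D → ¬ (N.regionNetwork A).ReachSet x (N.target A d D)

/-- The invariant of stage `j` of the discharge of the region `A`, with current flow `g`. -/
structure StageInvariant [Fintype V] (j : ℕ) (g : V → V → ℤ) : Prop where
  off : ∀ u v, ¬ (N.regionNetwork A).E u v → g u v = 0
  antisymm : ∀ u v, g u v = - g v u
  capacity : ∀ u v, g u v ≤ (N.regionNetwork A).c u v
  excess_nonneg : ∀ v ∈ A, 0 ≤ ((N.regionNetwork A).residual g).e v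
  inflow_nonneg : ∀ v, v ∉ A → 0 ≤ ∑ u, g u v
  excess : ∀ v ∈ A, 0 < ((N.regionNetwork A).residual g).e v → 0 < N.e v
  blocked : ∀ v ∈ A, 0 < ((N.regionNetwork A).residual g).e v → ∀ i < j,
    ¬ ((N.regionNetwork A).residual g).ReachSet v (N.target A d i)
  reachSet : ∀ i u, ((N.regionNetwork A).residual g).ReachSet u (N.target A d i) →
    (N.regionNetwork A).ReachSet u (N.target A d i)
  -- Flow into `w` opens edges out of `w`. This clause keeps them compatible with the labels, and it
  -- keeps augmenting paths of the stages `j ≤ d w` away from `w`.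
  back : ∀ w ∈ N.regionBoundary A, ∀ u, ((N.regionNetwork A).residual g).PosEdge w u →
    ¬ ((N.regionNetwork A).residual g).ReachSet u (N.target A d (d w))
  source : ∀ v, v ≠ N.s → ¬ ((N.regionNetwork A).residual g).PosEdge N.s v
  -- The vertex `x` is the start of a path that ended in `w`; after relabeling, its label exceeds `d
  -- w`.
  inflow : ∀ w, w ∉ A → w ≠ N.t → 0 < ∑ u, g u w → w ∈ N.regionBoundary A ∧ d w < D ∧
    ∃ x ∈ A, 0 < N.e x ∧ d x < D ∧
      ¬ ((N.regionNetwork A).residual g).ReachSet x (N.target A d (d w))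

variable {N A d D}

theorem residual_zero_posEdge [Fintype V] {M : Network V} {u v : V} :
    (M.residual 0).PosEdge u v ↔ M.PosEdge u v := by
  simp [PosEdge, residual]

theorem residual_e_of_mem [Fintype V] (h : DischargeReady N A d D) {v : V} (hv : v ∈ A)
    (g : V → V → ℤ) : ((N.regionNetwork A).residual g).e v = N.e v + ∑ u, g u v := by
  have : v ≠ N.t := fun e => h.t_not_mem (e ▸ hv)
  exact (if_neg this).trans (congrArg (· + _) (regionNetwork_e_of_mem hv))

theorem residual_hasExcess_iff [Fintype V] (h : DischargeReady N A d D) {v : V} (hv : v ∈ A)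
    (g : V → V → ℤ) : ((N.regionNetwork A).residual g).HasExcess v ↔
      0 < ((N.regionNetwork A).residual g).e v := by
  have h1 : v ≠ N.t := fun e => h.t_not_mem (e ▸ hv)
  have h2 : v ≠ N.s := fun e => h.s_not_mem (e ▸ hv)
  exact ⟨fun h => h.2.resolve_left h2, fun h => ⟨h1, .inr h⟩⟩

theorem StageInvariant.zero [Fintype V] (h : DischargeReady N A d D) :
    StageInvariant N A d D 0 0 where
  off _ _ _ := rfl
  antisymm _ _ := by simp
  capacity u v := by
    rcases regionNetwork_c_eq_zero_or (N := N) (A := A) u v with h' | h'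
    · rw [h']; rfl
    · rw [h']; exact h.c_nonneg u v
  excess_nonneg v hv := by
    rw [residual_e_of_mem h hv]; simpa using h.e_nonneg v hv
  inflow_nonneg v _ := by simp
  excess v hv h' := by
    rw [residual_e_of_mem h hv] at h'; simpa using h'
  blocked _ _ _ i hi := absurd hi (Nat.not_lt_zero i)
  reachSet i u h' := h'.imp fun y hy => ⟨hy.1, ReflTransGen.mono
    (fun _ _ => (residual_zero_posEdge (M := N.regionNetwork A)).1) _ _ hy.2⟩
  back w hw u hwu := absurd (residual_zero_posEdge.1 hwu) (not_posEdge_regionNetwork_of_boundary hw)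
  source v hv h' := h.source v hv (residual_zero_posEdge.1 h').of_regionNetwork
  inflow w _ _ hw := by simp at hw

theorem StageInvariant.next [Fintype V] (h : DischargeReady N A d D) {j : ℕ} {g : V → V → ℤ}
    (hg : StageInvariant N A d D j g)
    (hno : ∀ g', ¬ (N.regionNetwork A).AugmentStep A (N.target A d j) g g') :
    StageInvariant N A d D (j + 1) g :=
  { hg with
    -- The new case is `i = j`, the stage just exhausted; the smaller targets are contained in that
    -- one.
    blocked := fun _ hv he _ hi hr =>
      not_reachSet_of_no_augmentStep _ hno hv ((residual_hasExcess_iff h hv g).2 he)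
        (hr.mono _ (target_mono (Nat.le_of_lt_succ hi))) }

/-- With respect to each target `T_i` the path is uniform: all its vertices reach `T_i` or none
does. So reachability only shrinks and the negative clauses survive. The excess of the region drops
because flow leaves it for good at a target outside it. -/
theorem StageInvariant.augment [Fintype V] (h : DischargeReady N A d D) {j : ℕ} (hj : j ≤ D)
    {g g' : V → V → ℤ} (hg : StageInvariant N A d D j g)
    (hs : (N.regionNetwork A).AugmentStep A (N.target A d j) g g') :
    StageInvariant N A d D j g' ∧ ∑ v ∈ A, ((N.regionNetwork A).residual g').e v <
      ∑ v ∈ A, ((N.regionNetwork A).residual g).e v := by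
  classical
  obtain ⟨v₀, w, Δ, P, φ, hv₀, hw, hΔ, he₀, hΔe, hv₀P, hP, hφ, hφc, hsum, rfl⟩ :=
    hs.exists_flow _ h.s_not_mem
  have hv₀ : v₀ ∈ A := hv₀
  have hwA : w ∉ A := by
    rintro hwA
    rcases hw with hw | hw
    · exact h.t_not_mem (hw ▸ hwA)
    · exact hw.1.1 hwA
  have hws : w ≠ N.s := by
    rcases hw with hw | hw
    · exact fun e => h.s_ne_t (e.symm.trans hw)
    · exact hw.1.2.1
  -- No residual edge leaves `s` and the path does not end there, so it cannot pass through `s`.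
  have hsP : N.s ∉ P := by
    intro hsP
    rcases ReflTransGen.cases_head (hP _ hsP).2 with e | ⟨y, hy, hyw⟩
    · exact hws e.symm
    · have : ∀ y, ((N.regionNetwork A).residual g).Reach N.s y → y = N.s := by
        intro y hy
        induction hy with
        | refl => rfl
        | tail _ hbc ih =>
          subst ih
          by_contra hc
          exact hg.source _ hc hbc
      exact hws (this w (.head hy hyw))
  set M := N.regionNetwork A with hM
  set g' : V → V → ℤ := fun u v => g u v + φ u v with hg'
  have hc (u v : V) : (M.residual g').c u v = (M.residual g).c u v - φ u v := by
    simp only [residual, hg']; ring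
  have hsum' (v : V) : ∑ u, g' u v = ∑ u, g u v + ((if v = w then Δ else 0) - (if v = v₀ then Δ else 0)) := by
    rw [← hsum v, ← Finset.sum_add_distrib]
  have he (v : V) (hv : v ∈ A) : (M.residual g').e v = (M.residual g).e v - (if v = v₀ then Δ else 0) := by
    have : v ≠ w := fun e => hwA (e ▸ hv)
    rw [residual_e_of_mem h hv, residual_e_of_mem h hv, hsum', if_neg this]
    ring
  -- Capacity grows only on reversals of path edges.
  have hedge (u v : V) (huv : (M.residual g').PosEdge u v) :
      (M.residual g).PosEdge u v ∨ u ∈ P ∧ v ∈ P := by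
    rcases le_or_gt 0 (φ u v) with h0 | h0
    · exact .inl ⟨huv.1, by have := huv.2; rw [hc] at this; linarith⟩
    · rcases hφc v u with h1 | h1
      · rw [hφ] at h0; linarith
      · exact .inr ⟨h1.2.1, h1.1⟩
  have hPj (i : ℕ) (hi : j ≤ i) (x : V) (hx : x ∈ P) : (M.residual g).ReachSet x (N.target A d i) :=
    ⟨w, target_mono hi hw, (hP x hx).2⟩
  -- Otherwise `v₀`, which has excess and reaches `x`, would reach a target of an earlier stage.
  have hPn (i : ℕ) (hi : i < j) (x : V) (hx : x ∈ P) : ¬ (M.residual g).ReachSet x (N.target A d i) :=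
    fun hr => hg.blocked v₀ hv₀ ((residual_hasExcess_iff h hv₀ g).1 he₀) i hi
      ((hP x hx).1.trans_reachSet _ hr)
  have hreach (i : ℕ) (u : V) (hr : (M.residual g').ReachSet u (N.target A d i)) :
      (M.residual g).ReachSet u (N.target A d i) := by
    refine reachSet_of_uniform _ (P := P) hedge ?_ hr
    rcases le_or_gt j i with hi | hi
    · exact .inl (hPj i hi)
    · exact .inr (hPn i hi)
  have hpos (v : V) (hv : v ∈ A) (h' : 0 < (M.residual g').e v) : 0 < (M.residual g).e v := by
    rw [he v hv] at h'
    split_ifs at h' <;> linarith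
  refine ⟨⟨fun u v huv => ?_, fun u v => ?_, fun u v => ?_, fun v hv => ?_, fun v hv => ?_,
    fun v hv h' => hg.excess v hv (hpos v hv h'),
    fun v hv h' i hi hr => hg.blocked v hv (hpos v hv h') i hi (hreach i v hr),
    fun i u hr => hg.reachSet i u (hreach i u hr), fun b hb u hbu hr => ?_, fun v hv hsv => ?_,
    fun b hb hbt hin => ?_⟩, ?_⟩
  · have h1 : φ u v ≤ 0 := (hφc u v).resolve_right fun h' => huv h'.2.2.1.1
    have h2 : φ v u ≤ 0 := (hφc v u).resolve_right fun h' =>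
      huv (regionNetwork_E_symm h.symm h'.2.2.1.1)
    have h3 := hφ u v
    have h4 := hg.off u v huv
    simp only [hg']
    linarith
  · simp only [hg']
    rw [hg.antisymm, hφ]; ring
  · have := hg.capacity u v
    simp only [hg']
    rcases hφc u v with h' | h'
    · linarith
    · have := h'.2.2.2
      simp only [residual] at this
      linarith
  · rw [he v hv]
    have := hg.excess_nonneg v hv
    split_ifs with e
    · subst e; linarith
    · linarith
  · rw [hsum']
    have := hg.inflow_nonneg v hv
    have : v ≠ v₀ := fun e => hv (e ▸ hv₀)
    rw [if_neg this]
    split_ifs <;> linarith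
  · have hr := hreach _ _ hr
    rcases hedge b u hbu with hbu | ⟨hbP, huP⟩
    · exact hg.back b hb u hbu hr
    -- If `j ≤ d b`, then `b` is not the end of the path, and its successor reaches `T_j ⊆ T_{d b}`,
    -- against `back`. If `d b < j`, no path vertex reaches `T_{d b}`.
    · rcases le_or_gt j (d b) with hjb | hjb
      · have hbw : b ≠ w := by
          rintro rfl
          rcases hw with hw | hw
          · exact hb.2.2.1 hw
          · exact absurd hw.2 (not_lt.2 hjb)
        rcases ReflTransGen.cases_head (hP b hbP).2 with e | ⟨y, hby, hyw⟩
        · exact hbw e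
        · exact hg.back b hb y hby ⟨w, target_mono hjb hw, hyw⟩
      · exact hPn _ hjb u huP hr
  · rcases hedge _ _ hsv with h' | h'
    · exact hg.source v hv h'
    · exact hsP h'.1
  · rw [hsum'] at hin
    have : b ≠ v₀ := fun e => hb (e ▸ hv₀)
    rw [if_neg this] at hin
    by_cases hbw : b = w
    · subst hbw
      rcases hw with hw | hw
      · exact absurd hw hbt
      · have h0 := (residual_hasExcess_iff h hv₀ g).1 he₀
        have hN := hg.excess v₀ hv₀ h0
        refine ⟨hw.1, hw.2.trans_le hj, v₀, hv₀, hN, (h.d_le v₀).lt_of_ne fun e => ?_,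
          fun hr => hPn _ hw.2 v₀ hv₀P (hreach _ _ hr)⟩
        -- If `v₀` had label `D`, its present path to `T_j ⊆ T_D` would give one in the original
        -- region network.
        exact h.stuck v₀ hv₀ hN e (hg.reachSet D v₀ (hPj D hj v₀ hv₀P))
    · rw [if_neg hbw] at hin
      obtain ⟨h1, h2, x, hx, h3, h4, h5⟩ := hg.inflow b hb hbt (by linarith)
      exact ⟨h1, h2, x, hx, h3, h4, fun hr => h5 (hreach _ _ hr)⟩
  · refine Finset.sum_lt_sum (fun v hv => ?_) ⟨v₀, hv₀, ?_⟩
    · rw [he v hv]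
      split_ifs <;> linarith
    · rw [he v₀ hv₀, if_pos rfl]; linarith

end Network

/-! ### Region-relabel -/

namespace SARD

variable {V : Type*} {M : Network V} {A : Finset V} {T : ℕ → Set V} {D : ℕ} {d : V → ℕ}

theorem regionRelabel_of_not_mem {u : V} (hu : u ∉ A) : regionRelabel M A T D d u = d u :=
  if_neg hu

theorem regionRelabel_of_not_reachSet {u : V} (hu : u ∈ A) (h : ¬ M.ReachSet u (T D)) :
    regionRelabel M A T D d u = D :=
  (if_pos hu).trans (if_neg h)

theorem regionRelabel_of_reachSet {u : V} (hu : u ∈ A) (h : M.ReachSet u (T D)) :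
    regionRelabel M A T D d u = sInf {j | M.ReachSet u (T j)} :=
  (if_pos hu).trans (if_pos h)

theorem reachSet_regionRelabel {u : V} (hu : u ∈ A) (h : M.ReachSet u (T D)) :
    M.ReachSet u (T (regionRelabel M A T D d u)) := by
  rw [regionRelabel_of_reachSet hu h]
  exact Nat.sInf_mem (s := {j | M.ReachSet u (T j)}) ⟨D, h⟩

theorem regionRelabel_le {u : V} (hu : u ∈ A) : regionRelabel M A T D d u ≤ D := by
  by_cases h : M.ReachSet u (T D)
  · rw [regionRelabel_of_reachSet hu h]; exact Nat.sInf_le h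
  · rw [regionRelabel_of_not_reachSet hu h]

theorem regionRelabel_le_of_reachSet (hT : ∀ i j, i ≤ j → T i ⊆ T j) {u : V} (hu : u ∈ A) {i : ℕ}
    (h : M.ReachSet u (T i)) : regionRelabel M A T D d u ≤ i := by
  rcases le_total D i with hi | hi
  · exact (regionRelabel_le hu).trans hi
  · rw [regionRelabel_of_reachSet hu (h.mono _ (hT _ _ hi))]; exact Nat.sInf_le h

/-- The bound `i < D` is needed because a vertex that reaches no target gets the label `D`, not an
infinite one. -/
theorem lt_regionRelabel (hT : ∀ i j, i ≤ j → T i ⊆ T j) {u : V} (hu : u ∈ A) {i : ℕ} (hi : i < D)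
    (h : ¬ M.ReachSet u (T i)) : i < regionRelabel M A T D d u := by
  by_cases h' : M.ReachSet u (T D)
  · by_contra hle
    exact h ((reachSet_regionRelabel hu h').mono _ (hT _ _ (not_lt.1 hle)))
  · rwa [regionRelabel_of_not_reachSet hu h']

end SARD

/-! ### Monotonicity of labels, and the partition into regions -/

namespace Network

open SARD

section Region

variable {V : Type*} {N : Network V} {A : Finset V} {d : V → ℕ} {D : ℕ}

/-- Inside the region labels do not drop along positive edges, and the last edge, to a boundary
vertex of label below `i`, loses at most one. The induction also excludes `s`, which has no outgoing
positive edge. -/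
theorem DischargeReady.le_of_reachSet (h : DischargeReady N A d D) {i : ℕ} {u : V} (hu : u ∈ A)
    (hr : (N.regionNetwork A).ReachSet u (N.target A d i)) : d u ≤ i := by
  have key : (u ∈ A → d u ≤ i) ∧ (u ∈ N.regionBoundary A → d u < i) ∧ u ≠ N.s := by
    refine ReachSet.induction (N.regionNetwork A)
      (p := fun u => (u ∈ A → d u ≤ i) ∧ (u ∈ N.regionBoundary A → d u < i) ∧ u ≠ N.s)
      (fun y hy => ?_) (fun a b hab _ hb => ?_) hr
    · rcases hy with hy | hy
      · have hy : y = N.t := hy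
        subst hy
        exact ⟨fun h' => absurd h' h.t_not_mem, fun h' => absurd rfl h'.2.2.1, h.s_ne_t.symm⟩
      · exact ⟨fun h' => absurd h' hy.1.1, fun _ => hy.2, hy.1.2.1⟩
    · have hab' := hab.of_regionNetwork
      refine ⟨fun ha => ?_, fun ha => absurd hab (not_posEdge_regionNetwork_of_boundary ha), ?_⟩
      · by_cases hbA : b ∈ A
        · exact (h.d_le_of_mem a ha b hbA hab').trans (hb.1 hbA)
        · by_cases hbt : b = N.t
          · subst hbt; rw [h.d_le_of_sink a ha hab']; exact Nat.zero_le _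
          · have hbB : b ∈ N.regionBoundary A := ⟨hbA, hb.2.2, hbt, a, ha, hab'.1⟩
            exact (h.d_le_of_boundary a ha b hbB hab').trans (hb.2.1 hbB)
      · rintro rfl
        exact h.source b hb.2.2 hab'
  exact key.1 hu

/-- The new label is the index of a target that is reachable now, hence was reachable before the
discharge; the old label is a lower bound for such indices. -/
theorem StageInvariant.le_regionRelabel [Fintype V] (h : DischargeReady N A d D) {j : ℕ} {g : V → V → ℤ}
    (hg : StageInvariant N A d D j g) (u : V) :
    d u ≤ regionRelabel ((N.regionNetwork A).residual g) A (N.target A d) D d u := by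
  by_cases hu : u ∈ A
  · by_cases hr : ((N.regionNetwork A).residual g).ReachSet u (N.target A d D)
    · exact h.le_of_reachSet hu (hg.reachSet _ u (reachSet_regionRelabel hu hr))
    · rw [regionRelabel_of_not_reachSet hu hr]; exact h.d_le u
  · rw [regionRelabel_of_not_mem hu]

end Region

section Partition

variable {V : Type*} {K : ℕ} {N : Network V} {R : Fin K → Finset V}

theorem IsProper.capacity_nonneg {G : Network V} (hG : G.IsProper) (u v : V) : 0 ≤ G.c u v := by
  by_cases h : G.E u v
  · exact hG.c_nonneg u v h
  · rw [hG.c_off u v h]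

theorem IsRegionPartition.ne_s (hR : N.IsRegionPartition R) {k : Fin K} {v : V} (hv : v ∈ R k) :
    v ≠ N.s := ((hR.cover v).1 ⟨k, hv⟩).1

theorem IsRegionPartition.ne_t (hR : N.IsRegionPartition R) {k : Fin K} {v : V} (hv : v ∈ R k) :
    v ≠ N.t := ((hR.cover v).1 ⟨k, hv⟩).2

theorem IsRegionPartition.eq_of_mem (hR : N.IsRegionPartition R) {i j : Fin K} {v : V}
    (hi : v ∈ R i) (hj : v ∈ R j) : i = j := by
  by_contra h
  exact Finset.disjoint_left.1 (hR.disjoint i j h) hi hj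

theorem IsRegionPartition.not_interRegion (hR : N.IsRegionPartition R) {k : Fin K} {u v : V}
    (hu : u ∈ R k) (hv : v ∈ R k) : ¬ InterRegion R u v := by
  rintro ⟨i, j, hij, hi, hj⟩
  exact hij ((hR.eq_of_mem hi hu).trans (hR.eq_of_mem hv hj))

theorem IsRegionPartition.not_interRegion_right (hR : N.IsRegionPartition R) {u v : V}
    (hv : v = N.s ∨ v = N.t) : ¬ InterRegion R u v := by
  rintro ⟨i, j, hij, hi, hj⟩
  rcases hv with rfl | rfl
  · exact hR.ne_s hj rfl
  · exact hR.ne_t hj rfl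

theorem IsRegionPartition.interRegion (hR : N.IsRegionPartition R) {k : Fin K} {u v : V}
    (hu : u ∈ R k) (hv : v ∈ N.regionBoundary (R k)) : InterRegion R u v ∧ InterRegion R v u := by
  obtain ⟨i, hi⟩ := (hR.cover v).2 ⟨hv.2.1, hv.2.2.1⟩
  have : k ≠ i := fun e => hv.1 (e ▸ hi)
  exact ⟨⟨k, i, this, hu, hi⟩, ⟨i, k, this.symm, hi, hu⟩⟩

theorem InterRegion.symm {u v : V} (h : InterRegion R u v) : InterRegion R v u := by
  obtain ⟨i, j, hij, hi, hj⟩ := h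
  exact ⟨j, i, hij.symm, hj, hi⟩

end Partition

/-! ### Composition of preflows and the invariant between discharges -/

variable {V : Type*} [Fintype V] {K : ℕ}

theorem IsProper.residual {G : Network V} (hG : G.IsProper) {f : V → V → ℤ} (hf : G.IsPreflow f) :
    (G.residual f).IsProper where
  s_ne_t := hG.s_ne_t
  symm := hG.symm
  c_nonneg u v h := sub_nonneg.2 (hf.capacity u v h)
  c_off u v h := by
    change G.c u v - f u v = 0
    rw [hG.c_off u v h, hf.off u v h, sub_zero]
  e_nonneg v hv := by
    unfold Network.residual
    dsimp only
    split_ifs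
    · exact le_rfl
    · exact hf.preflow v hv
  e_t := if_pos rfl

theorem residual_e_of_ne {G : Network V} {v : V} (hv : v ≠ G.t) (f : V → V → ℤ) :
    (G.residual f).e v = G.e v + ∑ u, f u v := if_neg hv

theorem IsPreflow.add {G : Network V} (hG : G.IsProper) {f g : V → V → ℤ} (hf : G.IsPreflow f)
    (hg : (G.residual f).IsPreflow g) : G.IsPreflow fun u v => f u v + g u v where
  off u v h := by rw [hf.off u v h, hg.off u v h, add_zero]
  capacity u v h := by
    have := hg.capacity u v h
    simp only [Network.residual] at this
    linarith
  antisymm u v := by rw [hf.antisymm, hg.antisymm]; ring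
  preflow v hv := by
    have h1 := hg.preflow v hv
    rw [Finset.sum_add_distrib]
    -- The residual network resets the excess of the sink to `0`, so there the two preflow
    -- constraints are added instead.
    by_cases hvt : v = G.t
    · have h2 := hf.preflow v hv
      have : (G.residual f).e v = 0 := if_pos hvt
      rw [hvt, hG.e_t] at h2 ⊢
      rw [this, hvt] at h1
      linarith
    · rw [residual_e_of_ne hvt] at h1
      linarith

theorem residual_residual (G : Network V) (f g : V → V → ℤ) :
    (G.residual f).residual g = G.residual fun u v => f u v + g u v := by
  unfold Network.residual
  simp only [Network.mk.injEq, true_and]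
  constructor
  · funext u v; ring
  · funext v
    split_ifs
    · rfl
    · rw [Finset.sum_add_distrib]; ring

/-- The invariant of the sequential algorithm between two discharges. -/
structure Good (N : Network V) (R : Fin K → Finset V) (d : V → ℕ) : Prop where
  proper : N.IsProper
  valid : N.IsValidLabeling R d
  d_s : d N.s = N.dInf R
  source : ∀ v, v ≠ N.s → ¬ N.PosEdge N.s v
  -- The guard is needed at the start: if `d^∞ = 0`, every label is already maximal. No sweep begins
  -- in that case.
  stuck : 0 < N.dInf R → ∀ k, ∀ x ∈ R k, 0 < N.e x → d x = N.dInf R →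
    ¬ (N.regionNetwork (R k)).ReachSet x (N.target (R k) d (N.dInf R))

section Partition

variable {N : Network V} {R : Fin K → Finset V}

theorem mem_boundary {v : V} : v ∈ N.boundary R ↔ ∃ k, v ∈ N.regionBoundary (R k) := by
  simp [boundary]

theorem mem_boundary_of_interRegion (hR : N.IsRegionPartition R) {u v : V}
    (h : InterRegion R u v) (hE : N.E u v) : v ∈ N.boundary R := by
  obtain ⟨i, j, hij, hi, hj⟩ := h
  exact mem_boundary.2 ⟨i, fun h => hij (hR.eq_of_mem h hj), hR.ne_s hj, hR.ne_t hj, u, hi, hE⟩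

theorem Good.dischargeReady (hR : N.IsRegionPartition R) {d : V → ℕ} (h : Good N R d)
    (hD : 0 < N.dInf R) (k : Fin K) : DischargeReady N (R k) d (N.dInf R) where
  s_not_mem hs := hR.ne_s hs rfl
  t_not_mem ht := hR.ne_t ht rfl
  s_ne_t := h.proper.s_ne_t
  symm := h.proper.symm
  c_nonneg := h.proper.capacity_nonneg
  e_nonneg v hv := h.proper.e_nonneg v (hR.ne_s hv)
  source := h.source
  d_le := h.valid.le_dInf
  d_t := h.valid.sink
  d_le_of_mem u hu v hv huv := h.valid.intra u v huv (hR.not_interRegion hu hv)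
  d_le_of_sink u _ hut := Nat.le_zero.1
    ((h.valid.intra u _ hut (hR.not_interRegion_right (.inr rfl))).trans h.valid.sink.le)
  d_le_of_boundary u hu w hw huw := h.valid.inter u w huw (hR.interRegion hu hw).1
  stuck := h.stuck hD k

theorem StageInvariant.isPreflow {A : Finset V} {d : V → ℕ} {D j : ℕ} {g : V → V → ℤ}
    (h : DischargeReady N A d D) (hN : N.IsProper) (hg : StageInvariant N A d D j g) :
    N.IsPreflow g where
  off u v huv := hg.off u v fun h' => huv h'.1
  capacity u v _ := by
    refine (hg.capacity u v).trans ?_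
    rcases regionNetwork_c_eq_zero_or (N := N) (A := A) u v with h' | h'
    · rw [h']; exact h.c_nonneg u v
    · exact h'.le
  antisymm := hg.antisymm
  preflow v hv := by
    by_cases hvA : v ∈ A
    · rw [← residual_e_of_mem h hvA]; exact hg.excess_nonneg v hvA
    · exact add_nonneg (hN.e_nonneg v hv) (hg.inflow_nonneg v hvA)

end Partition

/-! ### Validity after a discharge -/

section Discharge

variable {N : Network V} {R : Fin K → Finset V} {d : V → ℕ} {g : V → V → ℤ} {k : Fin K}

theorem PosEdge.region_of_residual {A : Finset V} {u v : V} (hu : u ∈ A)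
    (h : (N.residual g).PosEdge u v) : ((N.regionNetwork A).residual g).PosEdge u v := by
  have hE : N.E u v := h.1
  refine ⟨regionNetwork_E_of_left hu hE, ?_⟩
  change 0 < (N.regionNetwork A).c u v - g u v
  rw [regionNetwork_c_of_left hu hE]
  exact h.2

theorem StageInvariant.posEdge_or {A : Finset V} {D j : ℕ} (hg : StageInvariant N A d D j g) {u v : V}
    (h : (N.residual g).PosEdge u v) : N.PosEdge u v ∨ 0 < g v u := by
  rcases le_or_gt (g v u) 0 with h' | h'
  · have h1 := hg.antisymm u v
    have h2 : 0 < N.c u v - g u v := h.2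
    exact .inl ⟨h.1, by linarith⟩
  · exact .inr h'

/-- Outside the region, the region network has edges only among `s` and `t`, so the flow vanishes on
all other such pairs. -/
theorem StageInvariant.posEdge_of_not_mem {A : Finset V} {D j : ℕ} (hg : StageInvariant N A d D j g)
    {u v : V} (hu : u ∉ A) (hv : v ∉ A) (h : ¬ ((u = N.s ∨ u = N.t) ∧ (v = N.s ∨ v = N.t)))
    (huv : (N.residual g).PosEdge u v) : N.PosEdge u v := by
  refine ⟨huv.1, ?_⟩
  have h0 : g u v = 0 := hg.off u v fun h' => by
    have := h'.2
    tauto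
  have h2 : 0 < N.c u v - g u v := huv.2
  linarith

theorem StageInvariant.residual_source {A : Finset V} {D j : ℕ} (h : DischargeReady N A d D)
    (hg : StageInvariant N A d D j g) (v : V) (hv : v ≠ N.s) : ¬ (N.residual g).PosEdge N.s v := by
  intro hsv
  by_cases hvA : v ∈ A ∨ v = N.s ∨ v = N.t
  · refine hg.source v hv ⟨⟨hsv.1, .inl ⟨.inr (.inl rfl), hvA⟩⟩, ?_⟩
    change 0 < (N.regionNetwork A).c N.s v - g N.s v
    have : (N.regionNetwork A).c N.s v = N.c N.s v :=
      if_pos ⟨hsv.1, .inl ⟨.inr (.inl rfl), hvA⟩⟩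
    rw [this]
    exact hsv.2
  · push Not at hvA
    exact h.source v hv (hg.posEdge_of_not_mem h.s_not_mem hvA.1 (by tauto) hsv)

/-- After sending flow from `u` in the region to `w` on its boundary, `u` reaches no target whose label is
below that of `w`. -/
theorem StageInvariant.not_reachSet_of_flow {A : Finset V} {D j : ℕ} (h : DischargeReady N A d D)
    (hg : StageInvariant N A d D j g) {u w : V} (hu : u ∈ A) (hw : w ∈ N.regionBoundary A)
    (hE : N.E u w) (hgu : 0 < g u w) :
    ¬ ((N.regionNetwork A).residual g).ReachSet u (N.target A d (d w)) := by
  -- The flow from `u` to `w` opens the reverse edge, whose original capacity is nonnegative, so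
  -- `back` applies to it.
  refine hg.back w hw u ⟨regionNetwork_E_symm h.symm (regionNetwork_E_of_left hu hE), ?_⟩
  change 0 < (N.regionNetwork A).c w u - g w u
  have h1 := hg.antisymm u w
  have h2 : 0 ≤ (N.regionNetwork A).c w u := by
    rcases regionNetwork_c_eq_zero_or (N := N) (A := A) w u with h' | h'
    · rw [h']
    · rw [h']; exact h.c_nonneg w u
  linarith

/-- Edges leaving a vertex of the region are handled by prepending them to a shortest path. An edge
from the boundary into the region is either old, and then only its head was raised, or opened by
flow, and then its head does not reach the target indexed by the label of its tail. -/
theorem StageInvariant.valid_step (hR : N.IsRegionPartition R) (hN : Good N R d) (hD : 0 < N.dInf R)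
    {j : ℕ} (hg : StageInvariant N (R k) d (N.dInf R) j g) {d' : V → ℕ}
    (hd' : d' = regionRelabel ((N.regionNetwork (R k)).residual g) (R k) (N.target (R k) d)
      (N.dInf R) d) {a b : V} (hab : (N.residual g).PosEdge a b) :
    d' a ≤ d' b ∨ InterRegion R a b ∧ d' a ≤ d' b + 1 := by
  have h := hN.dischargeReady hR hD k
  have hle (u) : d u ≤ d' u := by rw [hd']; exact hg.le_regionRelabel h u
  have hout (u) (hu : u ∉ R k) : d' u = d u := by rw [hd']; exact regionRelabel_of_not_mem hu
  have hin (u) (hu : u ∈ R k) : d' u ≤ N.dInf R := by rw [hd']; exact regionRelabel_le hu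
  by_cases hat : a = N.t
  · subst hat; left; rw [hout _ h.t_not_mem, h.d_t]; exact Nat.zero_le _
  by_cases has : a = N.s
  · subst has
    by_cases hb : b = N.s
    · subst hb; exact .inl le_rfl
    · exact absurd hab (hg.residual_source h b hb)
  by_cases ha : a ∈ R k
  · have hZ := hab.region_of_residual ha
    by_cases hb : b ∈ R k
    · left
      by_cases hr : ((N.regionNetwork (R k)).residual g).ReachSet b (N.target (R k) d (N.dInf R))
      · have := reachSet_regionRelabel (d := d) hb hr
        rw [hd']
        exact regionRelabel_le_of_reachSet (fun i j => target_mono) ha (this.head _ hZ)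
      · refine (hin a ha).trans (le_of_eq ?_)
        rw [hd', regionRelabel_of_not_reachSet hb hr]
    by_cases hbs : b = N.s
    · subst hbs; left; rw [hout _ h.s_not_mem, hN.d_s]; exact hin a ha
    by_cases hbt : b = N.t
    · subst hbt; left; rw [hout _ h.t_not_mem, h.d_t, hd']
      exact regionRelabel_le_of_reachSet (fun i j => target_mono) ha ⟨N.t, .inl rfl, .single hZ⟩
    · have hbB : b ∈ N.regionBoundary (R k) := ⟨hb, hbs, hbt, a, ha, hab.1⟩
      refine .inr ⟨(hR.interRegion ha hbB).1, ?_⟩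
      rw [hout b hb, hd']
      exact regionRelabel_le_of_reachSet (fun i j => target_mono) ha
        ⟨b, .inr ⟨hbB, Nat.lt_succ_self _⟩, .single hZ⟩
  · rw [hout a ha]
    by_cases hb : b ∈ R k
    · have haB : a ∈ N.regionBoundary (R k) := ⟨ha, has, hat, b, hb, h.symm _ _ hab.1⟩
      refine .inr ⟨(hR.interRegion hb haB).2, ?_⟩
      rcases hg.posEdge_or hab with h' | h'
      · exact (hN.valid.inter a b h' (hR.interRegion hb haB).2).trans (Nat.succ_le_succ (hle b))
      · have hr := hg.not_reachSet_of_flow h hb haB (h.symm _ _ hab.1) h'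
        rcases (h.d_le a).lt_or_eq with haD | haD
        · have := lt_regionRelabel (d := d) (fun i j => target_mono) hb haD hr
          rw [← hd'] at this
          omega
        · rw [haD] at hr
          have : d' b = N.dInf R := by rw [hd', regionRelabel_of_not_reachSet hb hr]
          omega
    · rw [hout b hb]
      have hN' := hg.posEdge_of_not_mem ha hb (by tauto) hab
      by_cases hi : InterRegion R a b
      · exact .inr ⟨hi, hN.valid.inter a b hN' hi⟩
      · exact .inl (hN.valid.intra a b hN' hi)

end Discharge

end Network

/-! ### Preservation of the invariant and motion of excess -/

namespace Network

open SARD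

theorem PosEdge.regionNetwork {V : Type*} {N : Network V} {A : Finset V} {u v : V} (hu : u ∈ A)
    (h : N.PosEdge u v) : (N.regionNetwork A).PosEdge u v :=
  ⟨regionNetwork_E_of_left hu h.1, (regionNetwork_c_of_left hu h.1).symm ▸ h.2⟩

variable {V : Type*} [Fintype V] {K : ℕ} {N : Network V} {R : Fin K → Finset V} {d : V → ℕ}

/-- Only this inclusion holds in general: restricting afterwards deletes the boundary-to-region
edges which the flow has opened. -/
theorem posEdge_residual_regionNetwork {A : Finset V} {g : V → V → ℤ} {u v : V}
    (h : ((N.residual g).regionNetwork A).PosEdge u v) :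
    ((N.regionNetwork A).residual g).PosEdge u v := by
  refine ⟨h.1, ?_⟩
  have h' := h.2
  unfold regionNetwork at h'
  dsimp only at h'
  split_ifs at h' with hc
  · change 0 < (N.regionNetwork A).c u v - g u v
    have : (N.regionNetwork A).c u v = N.c u v := if_pos hc
    rw [this]
    exact h'
  · exact absurd h' (lt_irrefl 0)

section Discharge

variable {g : V → V → ℤ} {k : Fin K} {d' : V → ℕ}

theorem StageInvariant.regionRelabel_of_excess {A : Finset V} {D : ℕ} (h : DischargeReady N A d D)
    (hg : StageInvariant N A d D (D + 1) g) {x : V} (hx : x ∈ A) (he : 0 < (N.residual g).e x) :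
    ¬ ((N.regionNetwork A).residual g).ReachSet x (N.target A d D) := by
  refine hg.blocked x hx ?_ D (Nat.lt_succ_self D)
  rw [residual_e_of_mem h hx]
  rwa [residual_e_of_ne fun e => h.t_not_mem (e ▸ hx)] at he

/-- The delicate clause is `stuck`. For the discharged region it is the exhaustion of the last
stage. For another region, any escape route from a vertex of label `D` is shown to have existed
before. -/
theorem Good.discharge (hR : N.IsRegionPartition R) (hN : Good N R d) (hD : 0 < N.dInf R)
    (hg : StageInvariant N (R k) d (N.dInf R) (N.dInf R + 1) g)
    (hd' : d' = regionRelabel ((N.regionNetwork (R k)).residual g) (R k) (N.target (R k) d)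
      (N.dInf R) d) : Good (N.residual g) R d' := by
  have h := hN.dischargeReady hR hD k
  have hle (u) : d u ≤ d' u := by rw [hd']; exact hg.le_regionRelabel h u
  have hout (u) (hu : u ∉ R k) : d' u = d u := by rw [hd']; exact regionRelabel_of_not_mem hu
  have hmax (u) : d' u ≤ N.dInf R := by
    by_cases hu : u ∈ R k
    · rw [hd']; exact regionRelabel_le hu
    · rw [hout u hu]; exact h.d_le u
  have hval : (N.residual g).IsValidLabeling R d' := by
    refine ⟨hmax, (hout _ h.t_not_mem).trans h.d_t, fun u v huv hi => ?_, fun u v huv hi => ?_⟩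
    · rcases hg.valid_step hR hN hD hd' huv with h' | h'
      · exact h'.trans (Nat.le_succ _)
      · exact h'.2
    · rcases hg.valid_step hR hN hD hd' huv with h' | h'
      · exact h'
      · exact absurd h'.1 hi
  refine ⟨hN.proper.residual (hg.isPreflow h hN.proper), hval,
    (hout _ h.s_not_mem).trans hN.d_s, hg.residual_source h, fun _ l x hx he hdx hr => ?_⟩
  by_cases hlk : l = k
  · subst hlk
    refine hg.regionRelabel_of_excess h hx he (ReachSet.induction _
      (p := fun u => ((N.regionNetwork (R l)).residual g).ReachSet u (N.target (R l) d (N.dInf R)))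
      (fun y hy => ⟨y, hy.imp id fun hy => ⟨hy.1, (hle y).trans_lt hy.2⟩, .refl⟩)
      (fun u v huv _ hv => hv.head _ (posEdge_residual_regionNetwork huv)) hr)
  · have hnot (u : V) (hu : u ∈ R l) : u ∉ R k := fun hu' => hlk (hR.eq_of_mem hu hu')
    have hdx' : d x = N.dInf R := (hout x (hnot x hx)).symm.trans hdx
    -- Flow enters only outside vertices of label below `D`, so the excess of `x` is old.
    have hex : 0 < N.e x := by
      rw [residual_e_of_ne (hR.ne_t hx)] at he
      by_contra hc
      have := (hg.inflow x (hnot x hx) (hR.ne_t hx) (by linarith)).2.1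
      omega
    refine hN.stuck hD l x hx hex hdx' ?_
    -- By validity the label stays `D` along the path inside `R l`, so the path cannot step to the
    -- sink and must exit at a boundary vertex of label below `D`.
    have key := ReachSet.induction _
      (p := fun u => u ≠ N.s ∧ (u ∈ N.regionBoundary (R l) → d' u < N.dInf R) ∧
        (u ∈ R l → d' u = N.dInf R →
          (N.regionNetwork (R l)).ReachSet u (N.target (R l) d (N.dInf R))))
      (fun y hy => ?_) (fun u v huv _ hv => ?_) hr
    · exact key.2.2 hx hdx
    · rcases hy with hy | hy
      · have hy : y = N.t := hy
        subst hy
        exact ⟨h.s_ne_t.symm, fun h' => absurd rfl h'.2.2.1, fun h' => absurd rfl (hR.ne_t h')⟩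
      · exact ⟨hy.1.2.1, fun _ => hy.2, fun h' => absurd h' hy.1.1⟩
    · have huv' := huv.of_regionNetwork
      refine ⟨?_, fun hu => absurd huv (not_posEdge_regionNetwork_of_boundary hu), fun hu hdu => ?_⟩
      · rintro rfl
        exact hg.residual_source h v hv.1 huv'
      by_cases hvl : v ∈ R l
      · have hdv : d' v = N.dInf R :=
          le_antisymm (hmax v) (hdu ▸ hval.intra u v huv' (hR.not_interRegion hu hvl))
        have := hg.posEdge_of_not_mem (hnot u hu) (hnot v hvl)
          (fun hc => hc.1.elim (hR.ne_s hu) (hR.ne_t hu)) huv'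
        exact (hv.2.2 hvl hdv).head _ (this.regionNetwork hu)
      by_cases hvt : v = N.t
      · have := hval.intra u v huv' (hR.not_interRegion_right (.inr hvt))
        have hsink : d' N.t = 0 := hval.sink
        rw [hdu, hvt, hsink] at this
        omega
      have hvB : v ∈ N.regionBoundary (R l) := ⟨hvl, hv.1, hvt, u, hu, huv'.1⟩
      have hdv := hv.2.1 hvB
      -- An exit edge into `R k` opened by flow would have a head that does not reach `T_D`, and
      -- that head would have been relabeled to `D`.
      have huvN : N.PosEdge u v := by
        by_cases hvk : v ∈ R k
        · rcases hg.posEdge_or huv' with h' | h'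
          · exact h'
          · have hE := h.symm _ _ huv'.1
            have huB : u ∈ N.regionBoundary (R k) := ⟨hnot u hu, hR.ne_s hu, hR.ne_t hu, v, hvk, hE⟩
            have hr' := hg.not_reachSet_of_flow h hvk huB hE h'
            rw [← hout u (hnot u hu), hdu] at hr'
            rw [hd', regionRelabel_of_not_reachSet hvk hr'] at hdv
            exact absurd hdv (lt_irrefl _)
        · exact hg.posEdge_of_not_mem (hnot u hu) hvk
            (fun hc => hc.1.elim (hR.ne_s hu) (hR.ne_t hu)) huv'
      exact ⟨v, .inr ⟨hvB, (hle v).trans_lt hdv⟩, .single (huvN.regionNetwork hu)⟩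

theorem StageInvariant.not_isActive (hR : N.IsRegionPartition R) (hN : Good N R d)
    (hD : 0 < N.dInf R) (hg : StageInvariant N (R k) d (N.dInf R) (N.dInf R + 1) g)
    (hd' : d' = regionRelabel ((N.regionNetwork (R k)).residual g) (R k) (N.target (R k) d)
      (N.dInf R) d) {v : V} (hv : v ∈ R k) : ¬ (N.residual g).IsActive R d' v := by
  intro ha
  have hr := hg.regionRelabel_of_excess (hN.dischargeReady hR hD k) hv
    (ha.1.2.resolve_left (hR.ne_s hv))
  have := ha.2
  rw [hd', regionRelabel_of_not_reachSet hv hr] at this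
  exact lt_irrefl _ this

/-- A vertex outside the region `R k` which is active after the discharge of the region was active before,
or received flow from an active vertex of the region whose new label is larger. -/
theorem StageInvariant.isActive_or (hR : N.IsRegionPartition R) (hN : Good N R d)
    (hD : 0 < N.dInf R) (hg : StageInvariant N (R k) d (N.dInf R) (N.dInf R + 1) g)
    (hd' : d' = regionRelabel ((N.regionNetwork (R k)).residual g) (R k) (N.target (R k) d)
      (N.dInf R) d) {v : V} (hv : v ∉ R k) (ha : (N.residual g).IsActive R d' v) :
    N.IsActive R d v ∨ v ∈ N.boundary R ∧ ∃ x ∈ R k, N.IsActive R d x ∧ d v < d' x := by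
  have h := hN.dischargeReady hR hD k
  have hdv : d' v = d v := by rw [hd']; exact regionRelabel_of_not_mem hv
  have hlt : d v < N.dInf R := hdv ▸ ha.2
  have hvs : v ≠ N.s := fun e => by rw [e, hN.d_s] at hlt; exact lt_irrefl _ hlt
  have hvt : v ≠ N.t := ha.1.1
  have he := ha.1.2.resolve_left hvs
  rw [residual_e_of_ne hvt] at he
  rcases le_or_gt (∑ u, g u v) 0 with h0 | h0
  · exact .inl ⟨⟨hvt, .inr (by linarith)⟩, hlt⟩
  · obtain ⟨hvB, -, x, hx, hex, hdx, hr⟩ := hg.inflow v hv hvt h0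
    refine .inr ⟨mem_boundary.2 ⟨k, hvB⟩, x, hx, ⟨⟨hR.ne_t hx, .inr hex⟩, hdx⟩, ?_⟩
    rw [hd']
    exact lt_regionRelabel (fun i j => target_mono) hx hlt hr

end Discharge

/-! ### The gap heuristic -/

section Gap

variable {d' : V → ℕ}

/-- No positive edge descends from above `g` to `g` or below: only an inter-region edge can lower
the label, by at most one, and its head is a boundary vertex, so its label is not `g`. Thus raised
vertices reach no vertex that keeps a label of at most `g`. -/
theorem Good.gap (hR : N.IsRegionPartition R) (hN : Good N R d) (hgap : GapStep N R d d') :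
    Good N R d' := by
  obtain ⟨g, hg, hB, rfl⟩ := hgap
  have hcross (a b : V) (hab : N.PosEdge a b) (ha : g < d a) : g < d b := by
    by_cases hi : InterRegion R a b
    · have h1 := hN.valid.inter a b hab hi
      have h2 := hB b (mem_boundary_of_interRegion hR hi hab.1)
      omega
    · exact ha.trans_le (hN.valid.intra a b hab hi)
  have hle := hN.valid.le_dInf
  refine ⟨hN.proper, ⟨fun v => ?_, ?_, fun a b hab hi => ?_, fun a b hab hi => ?_⟩, ?_, hN.source,
    fun hD k x hx he hdx hr => ?_⟩
  · split_ifs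
    · exact le_rfl
    · exact hle v
  · simp [hN.valid.sink]
  · have h1 := hN.valid.inter a b hab hi
    have h2 := hcross a b hab
    have h3 := hle b
    split_ifs <;> omega
  · have h1 := hN.valid.intra a b hab hi
    have h2 := hcross a b hab
    have h3 := hle b
    split_ifs <;> omega
  · simp [hN.d_s]
  · have hsub (y : V) (hy : y ∈ N.target (R k) (fun u => if g < d u then N.dInf R else d u)
        (N.dInf R)) : d y ≤ g ∧ y ∈ N.target (R k) d (N.dInf R) := by
      rcases hy with hy | hy
      · have hy : y = N.t := hy
        subst hy
        rw [hN.valid.sink]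
        exact ⟨Nat.zero_le _, .inl rfl⟩
      · have h2 := hy.2
        dsimp only at h2
        split_ifs at h2 with h'
        · exact absurd h2 (lt_irrefl _)
        · exact ⟨not_lt.1 h', .inr ⟨hy.1, h2⟩⟩
    split_ifs at hdx with hgx
    · refine absurd hgx (not_lt.2 ?_)
      refine ReachSet.induction _ (p := fun u => d u ≤ g) (fun y hy => (hsub y hy).1)
        (fun a b hab _ hb => ?_) hr
      by_contra hc
      exact absurd (hcross a b hab.of_regionNetwork (not_le.1 hc)) (not_lt.2 hb)
    · exact hN.stuck hD k x hx he hdx (hr.mono _ fun y hy => (hsub y hy).2)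

theorem le_of_gapStep (hN : Good N R d) (hgap : GapStep N R d d') (v : V) : d v ≤ d' v := by
  obtain ⟨g, hg, hB, rfl⟩ := hgap
  have := hN.valid.le_dInf v
  dsimp only
  split_ifs <;> omega

theorem isActive_of_gapStep (hgap : GapStep N R d d') {v : V} (hv : N.IsActive R d' v) :
    N.IsActive R d v ∧ d' v = d v := by
  obtain ⟨g, hg, hB, rfl⟩ := hgap
  have h := hv.2
  dsimp only at h ⊢
  split_ifs at h ⊢
  · exact absurd h (lt_irrefl _)
  · exact ⟨⟨hv.1, h⟩, rfl⟩

end Gap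

/-! ### Maximality from a cut -/

section MaxPreflow

/-- A vertex with the maximal label does not reach the sink, unless `d^∞ = 0`. -/
theorem IsValidLabeling.not_reach_sink (hN : N.IsProper) (hR : N.IsRegionPartition R)
    (hd : N.IsValidLabeling R d) (hD : 0 < N.dInf R) {v : V} (hv : d v = N.dInf R) :
    ¬ N.Reach v N.t := by
  intro hr
  -- A path from label `D` to label `0` can descend from `i + 1` to `i` only through an inter-region
  -- edge, whose two ends are boundary vertices.
  have hcross (i : ℕ) (hi : i < N.dInf R) : ∃ a ∈ N.boundary R, ∃ b ∈ N.boundary R,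
      d a = i + 1 ∧ d b = i := by
    by_contra hno
    refine absurd (ReachSet.induction N (Y := {N.t}) (p := fun u => d u ≤ i) ?_
      (fun a b hab _ hb => ?_) ⟨N.t, rfl, hr⟩) (not_le.2 (hv ▸ hi))
    · rintro y rfl
      rw [hd.sink]; exact Nat.zero_le _
    · by_contra hc
      by_cases hi' : InterRegion R a b
      · have h1 := hd.inter a b hab hi'
        exact hno ⟨a, mem_boundary_of_interRegion hR hi'.symm (hN.symm _ _ hab.1),
          b, mem_boundary_of_interRegion hR hi' hab.1, by omega, by omega⟩
      · have h1 := hd.intra a b hab hi'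
        omega
  -- Pigeonhole: `D + 1` labels would occur on `D` boundary vertices. The label `D` itself comes
  -- from the upper end of the last crossing.
  have hsub : Finset.range (N.dInf R + 1) ⊆ (N.boundary R).image d := by
    intro i hi
    rw [Finset.mem_image]
    rcases (Nat.lt_succ_iff.1 (Finset.mem_range.1 hi)).lt_or_eq with hi | rfl
    · obtain ⟨a, -, b, hb, -, h⟩ := hcross i hi
      exact ⟨b, hb, h⟩
    · obtain ⟨a, ha, b, -, h, -⟩ := hcross (N.dInf R - 1) (by omega)
      exact ⟨a, ha, by omega⟩
  have := (Finset.card_le_card hsub).trans Finset.card_image_le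
  rw [Finset.card_range, dInf] at this
  omega

theorem sum_inflow_eq {G : Network V} {f : V → V → ℤ} (hf : G.IsPreflow f) (S : Finset V)
    [DecidableEq V] : ∑ v ∈ S, ∑ u, f u v = ∑ v ∈ S, ∑ u ∈ Sᶜ, f u v := by
  have h : ∑ v ∈ S, ∑ u ∈ S, f u v = 0 := by
    have h1 : ∑ v ∈ S, ∑ u ∈ S, f u v = - ∑ v ∈ S, ∑ u ∈ S, f u v := by
      conv_lhs => rw [Finset.sum_comm]
      rw [← Finset.sum_neg_distrib]
      refine Finset.sum_congr rfl fun v _ => ?_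
      rw [← Finset.sum_neg_distrib]
      exact Finset.sum_congr rfl fun u _ => hf.antisymm v u
    linarith
  have : ∀ v ∈ S, ∑ u, f u v = ∑ u ∈ S, f u v + ∑ u ∈ Sᶜ, f u v :=
    fun v _ => (Finset.sum_add_sum_compl S _).symm
  rw [Finset.sum_congr rfl this, Finset.sum_add_distrib, h, zero_add]

/-- Weak duality: the nonnegative final excesses in `S` include that of the sink, and flow inside
`S` cancels. -/
theorem IsPreflow.value_le {G : Network V} (hG : G.IsProper) {f : V → V → ℤ} (hf : G.IsPreflow f)
    {S : Finset V} [DecidableEq V] (ht : G.t ∈ S) (hs : G.s ∉ S) :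
    G.value f ≤ ∑ v ∈ S, G.e v + ∑ v ∈ S, ∑ u ∈ Sᶜ, G.c u v := by
  have h1 : G.value f ≤ ∑ v ∈ S, (G.e v + ∑ u, f u v) := by
    refine le_trans (le_of_eq ?_) (Finset.single_le_sum
      (fun v hv => hf.preflow v fun e => hs (e ▸ hv)) ht)
    rw [hG.e_t, zero_add, value]
  rw [Finset.sum_add_distrib, sum_inflow_eq hf] at h1
  refine h1.trans (add_le_add_right (Finset.sum_le_sum fun v _ => Finset.sum_le_sum fun u _ => ?_) _)
  by_cases h : G.E u v
  · exact hf.capacity u v h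
  · rw [hf.off u v h, hG.c_off u v h]

/-- For the set of vertices that reach `t`, every edge entering it is saturated and no vertex in it
other than `t` keeps excess, so weak duality is an equality. -/
theorem IsPreflow.isMaxPreflow {G : Network V} (hG : G.IsProper) {f : V → V → ℤ} (hf : G.IsPreflow f)
    (hno : ∀ v, (G.residual f).HasExcess v → ¬ (G.residual f).Reach v G.t) : G.IsMaxPreflow f := by
  classical
  refine ⟨hf, fun f' hf' => ?_⟩
  let S : Finset V := {v | (G.residual f).Reach v G.t}
  have ht : G.t ∈ S := Finset.mem_filter.2 ⟨Finset.mem_univ _, .refl⟩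
  have hs : G.s ∉ S := fun h =>
    hno G.s ⟨hG.s_ne_t, .inl rfl⟩ (Finset.mem_filter.1 h).2
  refine (hf'.value_le hG ht hs).trans (le_of_eq ?_)
  have h1 : ∑ v ∈ S, ∑ u ∈ Sᶜ, G.c u v = ∑ v ∈ S, ∑ u ∈ Sᶜ, f u v := by
    refine Finset.sum_congr rfl fun v hv => Finset.sum_congr rfl fun u hu => ?_
    by_cases h : G.E u v
    · refine le_antisymm ?_ (hf.capacity u v h)
      by_contra hc
      refine Finset.mem_compl.1 hu (Finset.mem_filter.2 ⟨Finset.mem_univ _, ?_⟩)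
      exact .head ⟨h, sub_pos.2 (not_le.1 hc)⟩ (Finset.mem_filter.1 hv).2
    · rw [hf.off u v h, hG.c_off u v h]
  rw [h1, ← sum_inflow_eq hf, ← Finset.sum_add_distrib, Finset.sum_eq_single_of_mem G.t ht, hG.e_t,
    zero_add, value]
  intro v hv hvt
  have hvs : v ≠ G.s := fun e => hs (e ▸ hv)
  refine le_antisymm ?_ (hf.preflow v hvs)
  by_contra hc
  refine hno v ⟨hvt, .inr ?_⟩ (Finset.mem_filter.1 hv).2
  rw [residual_e_of_ne hvt]
  exact not_le.1 hc

end MaxPreflow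

end Network

/-! ### The bound on the number of sweeps -/

namespace SARD

open Network

variable {V : Type*} [Fintype V] {K : ℕ}

section Potential

variable (N : Network V) (R : Fin K → Finset V) (d : V → ℕ)

/-- The bound on the labels of active vertices during sweep `n`, after the regions of index below `k` have
been processed. -/
def SweepBound (k n : ℕ) : Prop :=
  ∀ i : Fin K, ∀ v ∈ R i, N.IsActive R d v →
    ((i : ℕ) < k → v ∈ N.boundary R ∧ d v + n ≤ ∑ u ∈ N.boundary R, d u + N.dInf R) ∧
    -- A region not yet processed in sweep `n` still carries the bound of sweep `n - 1`, hence the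
    -- extra `1`. In the first sweep active vertices may lie off the boundary.
    (k ≤ i → (2 ≤ n → v ∈ N.boundary R) ∧ d v + n ≤ ∑ u ∈ N.boundary R, d u + N.dInf R + 1)

/-- The bound on the labels of active vertices after `n` sweeps. -/
def TestBound (n : ℕ) : Prop :=
  0 < n → ∀ v, N.IsActive R d v →
    v ∈ N.boundary R ∧ d v + n ≤ ∑ u ∈ N.boundary R, d u + N.dInf R

variable {N R d}

theorem isActive_ne_s (hN : Good N R d) {v : V} (hv : N.IsActive R d v) : v ≠ N.s := by
  rintro rfl
  exact absurd hv.2 (by rw [hN.d_s]; exact lt_irrefl _)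

theorem sum_boundary_le (hN : Good N R d) : ∑ u ∈ N.boundary R, d u ≤ N.dInf R ^ 2 := by
  refine (Finset.sum_le_card_nsmul _ _ _ fun u _ => hN.valid.le_dInf u).trans (le_of_eq ?_)
  rw [smul_eq_mul, sq]; rfl

theorem TestBound.sweepBound {n : ℕ} (h : TestBound N R d n) : SweepBound N R d 0 (n + 1) := by
  refine fun i v _ ha => ⟨fun h' => absurd h' (Nat.not_lt_zero _), fun _ => ?_⟩
  rcases Nat.eq_zero_or_pos n with rfl | hn
  · have := ha.2
    exact ⟨fun h' => by omega, by omega⟩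
  · have := h hn v ha
    exact ⟨fun _ => this.1, by omega⟩

theorem SweepBound.testBound (hR : N.IsRegionPartition R) (hN : Good N R d) {n : ℕ}
    (h : SweepBound N R d K n) : TestBound N R d n := by
  intro _ v ha
  obtain ⟨i, hi⟩ := (hR.cover v).2 ⟨isActive_ne_s hN ha, ha.1.1⟩
  exact (h i v hi ha).1 i.2

theorem TestBound.succ_le (hN : Good N R d) {n : ℕ} (h : TestBound N R d n) {v : V}
    (ha : N.IsActive R d v) : n + 1 ≤ 2 * N.dInf R ^ 2 + 1 := by
  have hD : 1 ≤ N.dInf R := Nat.one_le_iff_ne_zero.2 fun e => Nat.not_lt_zero _ (e ▸ ha.2)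
  have h1 := sum_boundary_le hN
  have h2 : N.dInf R ≤ N.dInf R ^ 2 := Nat.le_self_pow two_ne_zero _
  rcases Nat.eq_zero_or_pos n with rfl | hn
  · omega
  · have := (h hn v ha).2
    omega

theorem SweepBound.gap (hN : Good N R d) {d' : V → ℕ} (hgap : GapStep N R d d') {k n : ℕ}
    (h : SweepBound N R d k n) : SweepBound N R d' k n := by
  intro i v hv ha
  have h1 : ∑ u ∈ N.boundary R, d u ≤ ∑ u ∈ N.boundary R, d' u :=
    Finset.sum_le_sum fun u _ => le_of_gapStep hN hgap u
  obtain ⟨h2, h3⟩ := isActive_of_gapStep hgap ha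
  obtain ⟨h4, h5⟩ := h i v hv h2
  rw [h3]
  exact ⟨fun hi => ⟨(h4 hi).1, by have := (h4 hi).2; omega⟩,
    fun hi => ⟨(h5 hi).1, by have := (h5 hi).2; omega⟩⟩

/-- A vertex that becomes active is charged to a sender `x` with `d v < d' x`. The rise of the label
of `x` enters the sum and absorbs the unit of slack of the region of `x`, so the stronger bound
holds for `v`, wherever its region lies in the order. -/
theorem SweepBound.discharge (hR : N.IsRegionPartition R) (hN : Good N R d) (hD : 0 < N.dInf R)
    {k : Fin K} {n : ℕ} (hn : 0 < n) (h : SweepBound N R d k n) {g : V → V → ℤ}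
    (hg : StageInvariant N (R k) d (N.dInf R) (N.dInf R + 1) g) {d' : V → ℕ}
    (hd' : d' = regionRelabel ((N.regionNetwork (R k)).residual g) (R k) (N.target (R k) d)
      (N.dInf R) d) : SweepBound (N.residual g) R d' (k + 1) n := by
  classical
  have hle (u) : d u ≤ d' u := by
    rw [hd']; exact hg.le_regionRelabel (hN.dischargeReady hR hD k) u
  have hsum : ∑ u ∈ N.boundary R, d u ≤ ∑ u ∈ N.boundary R, d' u :=
    Finset.sum_le_sum fun u _ => hle u
  intro i v hv ha
  by_cases hvk : v ∈ R k
  · exact absurd ha (hg.not_isActive hR hN hD hd' hvk)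
  have hik : (i : ℕ) ≠ k := fun e => hvk (Fin.ext e ▸ hv)
  have hdv : d' v = d v := by rw [hd']; exact regionRelabel_of_not_mem hvk
  have hlt : d v < N.dInf R := hdv ▸ ha.2
  change ((i : ℕ) < k + 1 → v ∈ N.boundary R ∧ d' v + n ≤ ∑ u ∈ N.boundary R, d' u + N.dInf R) ∧
    (k + 1 ≤ (i : ℕ) → (2 ≤ n → v ∈ N.boundary R) ∧
      d' v + n ≤ ∑ u ∈ N.boundary R, d' u + N.dInf R + 1)
  rw [hdv]
  rcases hg.isActive_or hR hN hD hd' hvk ha with ha | ⟨hvB, x, hx, hax, hvx⟩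
  · obtain ⟨h1, h2⟩ := h i v hv ha
    exact ⟨fun hi => ⟨(h1 (by omega)).1, by have := (h1 (by omega)).2; omega⟩,
      fun hi => ⟨(h2 (by omega)).1, by have := (h2 (by omega)).2; omega⟩⟩
  · have key : d v + n ≤ ∑ u ∈ N.boundary R, d' u + N.dInf R := by
      obtain ⟨h1, h2⟩ := (h k x hx hax).2 le_rfl
      -- In the first sweep `x` need not be a boundary vertex, but then `d v + 1 ≤ D` suffices.
      rcases Nat.lt_or_ge n 2 with hn2 | hn2
      · omega
      · have hxB := h1 hn2
        have h3 := Finset.add_sum_erase _ d hxB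
        have h4 := Finset.add_sum_erase _ d' hxB
        have h5 : ∑ u ∈ (N.boundary R).erase x, d u ≤ ∑ u ∈ (N.boundary R).erase x, d' u :=
          Finset.sum_le_sum fun u _ => hle u
        omega
    exact ⟨fun _ => ⟨hvB, key⟩, fun _ => ⟨fun _ => hvB, by omega⟩⟩

end Potential

/-! ### The invariant of the whole execution -/

variable {G : Network V} {R : Fin K → Finset V}

/-- The part of the invariant which depends on the position in the program. -/
def ControlInvariant (N : Network V) (R : Fin K → Finset V) (d : V → ℕ) (n : ℕ) :
    Control V K → Prop
  | .test => TestBound N R d n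
  | .forLoop k => 0 < N.dInf R ∧ 0 < n ∧ SweepBound N R d k n ∧ k ≤ K
  | .stage k j g => 0 < N.dInf R ∧ 0 < n ∧ SweepBound N R d k n ∧ j ≤ N.dInf R ∧
      StageInvariant N (R k) d (N.dInf R) j g
  | .halted => ∀ v, ¬ N.IsActive R d v

/-- The invariant of the sequential algorithm. -/
structure Invariant (G : Network V) (R : Fin K → Finset V) (σ : State V K) : Prop where
  preflow : G.IsPreflow σ.f
  good : Good (G.residual σ.f) R σ.d
  sweeps_le : σ.sweeps ≤ 2 * G.dInf R ^ 2 + 1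
  control : ControlInvariant (G.residual σ.f) R σ.d σ.sweeps σ.control

theorem isPreflow_initFlow (hG : G.IsProper) : G.IsPreflow (initFlow G) where
  off u v h := by
    have h' : ¬ G.E v u := fun h' => h (hG.symm v u h')
    simp [initFlow, hG.c_off u v h, hG.c_off v u h']
  capacity u v _ := by
    have h1 := hG.capacity_nonneg u v
    have h2 := hG.capacity_nonneg v u
    unfold initFlow
    split_ifs <;> linarith
  antisymm u v := by
    unfold initFlow
    by_cases h : u = v
    · simp [h]
    · rw [if_neg h, if_neg (Ne.symm h)]
      by_cases hu : u = G.s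
      · have hv : v ≠ G.s := fun e => h (hu.trans e.symm)
        rw [if_pos hu, if_neg hv, if_pos hu, neg_neg]
      · rw [if_neg hu, if_neg hu]
        split_ifs <;> simp
  preflow v hv := by
    refine add_nonneg (hG.e_nonneg v hv) (Finset.sum_nonneg fun u _ => ?_)
    have h1 := hG.capacity_nonneg u v
    unfold initFlow
    rw [if_neg hv]
    split_ifs <;> linarith

theorem residual_initFlow_source (v : V) (hv : v ≠ G.s) :
    ¬ (G.residual (initFlow G)).PosEdge G.s v := by
  intro h
  have h' : 0 < G.c G.s v - initFlow G G.s v := h.2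
  rw [initFlow, if_neg hv.symm, if_pos rfl, sub_self] at h'
  exact lt_irrefl _ h'

open Classical in
theorem invariant_initState (hG : G.IsProper) (hR : G.IsRegionPartition R) :
    Invariant G R (initState G R) where
  preflow := isPreflow_initFlow hG
  good := by
    have hR' : (G.residual (initFlow G)).IsRegionPartition R := ⟨hR.disjoint, hR.cover⟩
    refine ⟨hG.residual (isPreflow_initFlow hG), ⟨fun v => ?_, ?_, fun a b _ hi => ?_,
      fun a b hab _ => ?_⟩, if_pos rfl, residual_initFlow_source (G := G), fun hD k x hx _ hdx => ?_⟩
    · change (if v = G.s then G.dInf R else 0) ≤ G.dInf R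
      split_ifs
      · exact le_rfl
      · exact Nat.zero_le _
    · exact if_neg hG.s_ne_t.symm
    · obtain ⟨i, -, -, ha, -⟩ := hi
      exact (if_neg (hR'.ne_s ha)).trans_le (Nat.zero_le _)
    · by_cases ha : a = G.s
      · subst ha
        by_cases hb : b = G.s
        · subst hb; exact le_rfl
        · exact absurd hab (residual_initFlow_source b hb)
      · exact (if_neg ha).trans_le (Nat.zero_le _)
    · have : (if x = G.s then G.dInf R else 0) = G.dInf R := hdx
      exact absurd ((if_neg (hR'.ne_s hx)).symm.trans this) hD.ne
  sweeps_le := Nat.zero_le _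
  control := fun h => absurd h (lt_irrefl 0)

theorem Invariant.step (hG : G.IsProper) (hR : G.IsRegionPartition R) {σ σ' : State V K}
    (hσ : Invariant G R σ) (hs : Step G R σ σ') : Invariant G R σ' := by
  obtain ⟨hf, hgood, hn, hc⟩ := hσ
  cases hs with
  | halt f d n h => exact ⟨hf, hgood, hn, h⟩
  | sweep f d n v h =>
    have hc : TestBound _ R d n := hc
    exact ⟨hf, hgood, hc.succ_le hgood h, Nat.zero_lt_of_lt h.2, Nat.succ_pos n, hc.sweepBound,
      Nat.zero_le K⟩
  | sweepEnd f d n =>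
    have hR' : (G.residual f).IsRegionPartition R := ⟨hR.disjoint, hR.cover⟩
    exact ⟨hf, hgood, hn, hc.2.2.1.testBound hR' hgood⟩
  | call f d n k =>
    have hR' : (G.residual f).IsRegionPartition R := ⟨hR.disjoint, hR.cover⟩
    exact ⟨hf, hgood, hn, hc.1, hc.2.1, hc.2.2.1, Nat.zero_le _,
      .zero (hgood.dischargeReady hR' hc.1 k)⟩
  | augment f d n k j g g' h =>
    have hR' : (G.residual f).IsRegionPartition R := ⟨hR.disjoint, hR.cover⟩
    obtain ⟨hD, hn0, hb, hj, hg⟩ := hc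
    exact ⟨hf, hgood, hn, hD, hn0, hb, hj,
      (hg.augment (hgood.dischargeReady hR' hD k) hj h).1⟩
  | nextStage f d n k j g hj h =>
    have hR' : (G.residual f).IsRegionPartition R := ⟨hR.disjoint, hR.cover⟩
    obtain ⟨hD, hn0, hb, -, hg⟩ := hc
    exact ⟨hf, hgood, hn, hD, hn0, hb, hj, hg.next (hgood.dischargeReady hR' hD k) h⟩
  | finish f d n k g d' d'' h hd' hd'' =>
    have hR' : (G.residual f).IsRegionPartition R := ⟨hR.disjoint, hR.cover⟩
    obtain ⟨hD, hn0, hb, -, hg⟩ := hc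
    have hready := hgood.dischargeReady hR' hD k
    -- Formally entering stage `D + 1` records that stage `D` is exhausted.
    have hg := hg.next hready h
    have hgood' : Good ((G.residual f).residual g) R d' := hgood.discharge hR' hD hg hd'
    have hb' : SweepBound ((G.residual f).residual g) R d' (k + 1) n :=
      hb.discharge hR' hgood hD hn0 hg hd'
    rw [residual_residual] at hgood' hb'
    refine ⟨hf.add hG (hg.isPreflow hready hgood.proper), ?_, hn, hD, hn0, ?_, k.2⟩
    · rcases hd'' with rfl | hgap
      · exact hgood'
      · exact hgood'.gap ⟨hR.disjoint, hR.cover⟩ hgap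
    · rcases hd'' with rfl | hgap
      · exact hb'
      · exact hb'.gap hgood' hgap

theorem Reachable.invariant (hG : G.IsProper) (hR : G.IsRegionPartition R) {σ : State V K}
    (h : Reachable G R σ) : Invariant G R σ := by
  induction h with
  | refl => exact invariant_initState hG hR
  | tail _ hs ih => exact ih.step hG hR hs

/-- A state of the algorithm which is not `halted` has a successor. -/
theorem Invariant.halted_of_no_step {σ : State V K} (hσ : Invariant G R σ)
    (h : ∀ σ', ¬ Step G R σ σ') : σ.control = .halted := by
  obtain ⟨f, d, n, c⟩ := σ
  cases c with
  | halted => rfl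
  | test =>
    exfalso
    by_cases ha : ∃ v, (G.residual f).IsActive R d v
    · exact h _ (.sweep f d n ha.choose ha.choose_spec)
    · exact h _ (.halt f d n (not_exists.1 ha))
  | forLoop k =>
    exfalso
    rcases hσ.control.2.2.2.lt_or_eq with hk | rfl
    · exact h _ (.call f d n ⟨k, hk⟩)
    · exact h _ (.sweepEnd f d n)
  | stage k j g =>
    exfalso
    by_cases ha : ∃ g', (currentRegion G R f k).AugmentStep (R k) (G.target (R k) d j) g g'
    · obtain ⟨g', hg'⟩ := ha
      exact h _ (.augment f d n k j g g' hg')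
    · have hj : j ≤ G.dInf R := hσ.control.2.2.2.1
      rcases hj.lt_or_eq with hj | rfl
      · exact h _ (.nextStage f d n k j g hj (not_exists.1 ha))
      · exact h _ (.finish f d n k g _ _ (not_exists.1 ha) rfl (.inl rfl))

/-! ### Termination -/

/-- The position within a sweep, decreasing during the sweep. -/
def phase : Control V K → ℕ
  | .test => 1
  | .forLoop k => 2 * (K - k) + 2
  | .stage k _ _ => 2 * (K - k) + 1
  | .halted => 0

/-- The number of remaining stages and the total excess left in the region. -/
noncomputable def stageMeasure (G : Network V) (R : Fin K → Finset V) (f : V → V → ℤ) : Control V K → ℕ ×ₗ ℕ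
  | .stage k j g => toLex (G.dInf R - j, (∑ v ∈ R k, ((currentRegion G R f k).residual g).e v).toNat)
  | _ => toLex (0, 0)

/-- A measure which decreases in every step. -/
noncomputable def stateMeasure (G : Network V) (R : Fin K → Finset V) (σ : State V K) : ℕ ×ₗ ℕ ×ₗ ℕ ×ₗ ℕ :=
  toLex (2 * G.dInf R ^ 2 + 1 - σ.sweeps, toLex (phase σ.control, stageMeasure G R σ.f σ.control))

theorem Invariant.stateMeasure_lt (hG : G.IsProper) (hR : G.IsRegionPartition R) {σ σ' : State V K}
    (hσ : Invariant G R σ) (hs : Step G R σ σ') : stateMeasure G R σ' < stateMeasure G R σ := by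
  have hσ' := hσ.step hG hR hs
  have hn := hσ'.sweeps_le
  cases hs with
  | halt f d n h => exact Prod.Lex.right _ (Prod.Lex.left _ _ Nat.zero_lt_one)
  | sweep f d n v h =>
    refine Prod.Lex.left _ _ ?_
    dsimp only at hn ⊢
    omega
  | sweepEnd f d n =>
    refine Prod.Lex.right _ (Prod.Lex.left _ _ ?_)
    simp only [phase]
    omega
  | call f d n k =>
    refine Prod.Lex.right _ (Prod.Lex.left _ _ ?_)
    simp only [phase]
    omega
  | augment f d n k j g g' h =>
    have hR' : (G.residual f).IsRegionPartition R := ⟨hR.disjoint, hR.cover⟩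
    obtain ⟨hD, -, -, hj, hg⟩ := hσ.control
    have hlt := (hg.augment (hσ.good.dischargeReady hR' hD k) hj h).2
    have h0 := Finset.sum_nonneg
      (hg.augment (hσ.good.dischargeReady hR' hD k) hj h).1.excess_nonneg
    refine Prod.Lex.right _ (Prod.Lex.right _ (Prod.Lex.right _ ?_))
    -- Truncation to `ℕ` keeps the decrease strict because the remaining excess is nonnegative.
    exact (Int.toNat_lt_toNat (h0.trans_lt hlt)).2 hlt
  | nextStage f d n k j g hj h =>
    refine Prod.Lex.right _ (Prod.Lex.right _ (Prod.Lex.left _ _ ?_))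
    omega
  | finish f d n k g d' d'' h hd' hd'' =>
    refine Prod.Lex.right _ (Prod.Lex.left _ _ ?_)
    have := k.2
    simp only [phase]
    omega

end SARD

open Network SARD in
theorem mainTheorem1 {V : Type*} [Fintype V] (G : Network V) (hG : G.IsProper)
    {K : ℕ} (R : Fin K → Finset V) (hR : G.IsRegionPartition R) :
    -- every execution is finite
    (¬ ∃ σ : ℕ → SARD.State V K, σ 0 = SARD.initState G R ∧
      ∀ n, SARD.Step G R (σ n) (σ (n + 1))) ∧
    -- and makes at most `2|𝓑|² + 1` sweeps
    (∀ σ, SARD.Reachable G R σ → σ.sweeps ≤ 2 * (G.boundary R).card ^ 2 + 1) ∧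
    -- a state from which the execution cannot continue is a correct final state
    (∀ σ, SARD.Reachable G R σ → (∀ σ', ¬ SARD.Step G R σ σ') →
      σ.control = .halted ∧
      G.IsPreflow σ.f ∧
      (G.residual σ.f).IsValidLabeling R σ.d ∧
      (∀ v, ¬ (G.residual σ.f).IsActive R σ.d v) ∧
      ((G.boundary R).Nonempty → G.IsMaxPreflow σ.f)) := by
  refine ⟨?_, fun σ hσ => (hσ.invariant hG hR).sweeps_le, fun σ hσ hfinal => ?_⟩
  · rintro ⟨σ, h0, hstep⟩
    have hreach (n : ℕ) : Reachable G R (σ n) := by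
      induction n with
      | zero => rw [h0]; exact .refl
      | succ n ih => exact .tail ih (hstep n)
    have hanti : StrictAnti fun n => stateMeasure G R (σ n) :=
      strictAnti_nat_of_succ_lt fun n => ((hreach n).invariant hG hR).stateMeasure_lt hG hR (hstep n)
    obtain ⟨n, hn⟩ := WellFounded.not_rel_apply_succ (r := (· < ·)) fun n => stateMeasure G R (σ n)
    exact hn (hanti (Nat.lt_succ_self n))
  · have hinv := hσ.invariant hG hR
    have hhalt := hinv.halted_of_no_step hfinal
    have hact : ∀ v, ¬ (G.residual σ.f).IsActive R σ.d v := by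
      have := hinv.control
      rwa [hhalt] at this
    refine ⟨hhalt, hinv.preflow, hinv.good.valid, hact, fun hB => ?_⟩
    have hD : 0 < G.dInf R := Finset.card_pos.2 hB
    -- A vertex with excess, the source included, is not active, so its label is `d^∞`.
    refine hinv.preflow.isMaxPreflow hG fun v hv => ?_
    refine hinv.good.valid.not_reach_sink hinv.good.proper ⟨hR.disjoint, hR.cover⟩ hD ?_
    by_contra hne
    exact hact v ⟨hv, (hinv.good.valid.le_dInf v).lt_of_ne hne⟩
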